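/- Let $\mathbb F$ be a finite field with $q$ elements and let $k$ be a field in which $q$ is invertible. Let $\mathrm{VI}$ be the category of finite-dimensional $\mathbb F$-vector spaces and injective linear maps. A $\mathrm{VI}$-module is a functor $M$ from $\mathrm{VI}$ to $k$-vector spaces. It is torsion if every element $x\in M(X)$ is killed by $M(g)$ for some morphism $g\colon X\to Y$ of $\mathrm{VI}$. Let $\mathrm{Mod}^{\mathrm{gen}}_{\mathrm{VI}}$ be the Serre quotient of the category of $\mathrm{VI}$-modules by the torsion modules (the generic category), and $T$ the localization functor to it. For a representation $\Theta$ of $\mathrm{GL}_d=\mathrm{GL}_d(\mathbb F)$ over $k$, let $\mathcal I(\Theta)=k[\mathrm{Hom}_{\mathrm{VI}}(\mathbb F^d,-)]\otimes_{\mathrm{GL}_d}\Theta$. For $n\ge d$ let $f\colon\mathbb F^d\to\mathbb F^n$ be the inclusion that sends the standard basis to $\alpha_1,\dots,\alpha_d$, the first $d$ standard basis vectors of $\mathbb F^n$, and put $W=\mathrm{im}(f)$. Let $\mathcal V$ be the set of triples $v=(\alpha_v,C_v,C'_v)$ such that $\alpha_v=\alpha_i$ for some $i$, $C_v$ is a complement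 of the line $\mathbb F\alpha_v$ in $W$ containing $\alpha_j$ for all $j<i$, and $C'_v$ is a complement of $W$ in $\mathbb F^n$. Let $\mathcal E$ be the $\mathbb F$-vector space with basis $(e_v)_{v\in\mathcal V}$. For $v\in\mathcal V$ let $\sigma_v$ be the automorphism of $\mathbb F^n\oplus\mathcal E$ that sends $\alpha_v$ to $e_v$ and fixes $C_v$, $C'_v$ and all vectors $\alpha_w-e_w$ ($w\in\mathcal V$). These automorphisms commute; let $L=\prod_{v\in\mathcal V}(\mathrm{id}-\sigma_v)$, acting on $\mathcal I(\Theta)(\mathbb F^n\oplus\mathcal E)$. Let $f^{\mathcal E}\colon\mathbb F^d\to\mathbb F^n\oplus\mathcal E$ be $f$ followed by the inclusion of $\mathbb F^n$, and let $M_{n,\Theta}\subset\mathcal I(\Theta)$ be the $\mathrm{VI}$-submodule generated by the elements $L([f^{\mathcal E}]\otimes\theta)$, $\theta\in\Theta$. Assume that $\Theta$ is an irreducible representation of $\mathrm{GL}_d$, where $d\ge 0$. Then for every $n\ge d$ the object $T(M_{n,\Theta})$ of $\mathrm{Mod}^{\mathrm{gen}}_{\mathrm{VI}}$ is irreducible,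 and, as a subobject of $T(\mathcal I(\Theta))$ through the inclusion $M_{n,\Theta}\subset\mathcal I(\Theta)$, it is the socle of $T(\mathcal I(\Theta))$, that is, the join of all simple subobjects. -/

import Mathlib

open CategoryTheory CategoryTheory.Limits

universe u

noncomputable section

/-! ## The category of finite dimensional vector spaces and injective linear maps -/

/-- Objects of the category `VI`: finite dimensional vector spaces over `F`. -/
structure VI (F : Type u) [Field F] : Type (u + 1) where
  carrier : Type u
  [addCommGroup : AddCommGroup carrier]
  [module : Module F carrier]
  [finite : Module.Finite F carrier]

namespace VI

variable {F : Type u} [Field F]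

instance : CoeSort (VI F) (Type u) := ⟨VI.carrier⟩

attribute [instance] VI.addCommGroup VI.module VI.finite

/-- Morphisms of `VI`: injective linear maps. -/
@[ext]
structure Hom (X Y : VI F) : Type u where
  toLinearMap : X →ₗ[F] Y
  injective : Function.Injective toLinearMap

instance : Category (VI F) where
  Hom X Y := Hom X Y
  id X := ⟨LinearMap.id, Function.injective_id⟩
  comp f g := ⟨g.toLinearMap ∘ₗ f.toLinearMap, g.injective.comp f.injective⟩

@[ext]
theorem hom_ext {X Y : VI F} {f g : X ⟶ Y} (h : f.toLinearMap = g.toLinearMap) : f = g :=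
  Hom.ext h

@[simp]
theorem id_toLinearMap (X : VI F) : Hom.toLinearMap (𝟙 X) = LinearMap.id := rfl

@[simp]
theorem comp_toLinearMap {X Y Z : VI F} (f : X ⟶ Y) (g : Y ⟶ Z) :
    (f ≫ g).toLinearMap = g.toLinearMap ∘ₗ f.toLinearMap := rfl

variable (F) in
/-- The standard object `F ^ n`. -/
abbrev std (n : ℕ) : VI F := ⟨Fin n → F⟩

/-- The direct sum `X + E` of two vector spaces. -/
abbrev sum (X E : VI F) : VI F := ⟨X × E⟩

/-- For `g : Y ⟶ X`, the morphism `g ^ E : Y ⟶ X + E`, the direct sum of `g` and `0 ⟶ E`. -/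
def extend {Y X : VI F} (g : Y ⟶ X) (E : VI F) : Y ⟶ sum X E where
  toLinearMap := LinearMap.inl F X E ∘ₗ g.toLinearMap
  injective := LinearMap.inl_injective.comp g.injective

/-- An invertible linear map, as an endomorphism in `VI`. -/
def ofEquiv {X Y : VI F} (e : X ≃ₗ[F] Y) : X ⟶ Y := ⟨e.toLinearMap, e.injective⟩

/-- An element of `GL_d`, as an endomorphism of `F ^ d` in `VI`. -/
def ofGL {d : ℕ} (σ : LinearMap.GeneralLinearGroup F (Fin d → F)) : std F d ⟶ std F d :=
  ofEquiv (X := std F d) (Y := std F d) (LinearMap.GeneralLinearGroup.toLinearEquiv σ)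

/-- The natural inclusion `F ^ d ⟶ F ^ n`, sending the standard basis of `F ^ d` to the initial
segment of the standard basis of `F ^ n`. -/
def stdIncl {d n : ℕ} (h : d ≤ n) : std F d ⟶ std F n where
  toLinearMap := Function.ExtendByZero.linearMap F (Fin.castLE h)
  injective := Function.extend_injective (Fin.castLE_injective h) (0 : Fin n → F)

/-! ## The triples attached to a morphism, and the automorphisms they define -/

section Triples

variable {d : ℕ} {X : VI F}

/-- The ordered basis of the image of `f : F ^ d ⟶ X` that is used throughout: the image under `f`
of the standard basis of `F ^ d`, with its usual order. -/
def imBasis (f : std F d ⟶ X) (i : Fin d) : X :=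
  f.toLinearMap (Pi.single i (1 : F) : Fin d → F)

/-- The triples `(α, C, C')`, where `α` is a member of the ordered basis of `W = im f` (recorded by
its index), `C` is a complement of the line `F α` in `W` that contains all the basis vectors
preceding `α`, and `C'` is a complement of `W` in `X`. -/
@[ext]
structure Triple (f : std F d ⟶ X) : Type u where
  idx : Fin d
  C : Submodule F X
  C' : Submodule F X
  disjoint : Disjoint (Submodule.span F {imBasis f idx}) C
  sup_eq : Submodule.span F {imBasis f idx} ⊔ C = LinearMap.range f.toLinearMap
  lower_mem : ∀ j < idx, imBasis f j ∈ C
  isCompl : IsCompl (LinearMap.range f.toLinearMap) C'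

/-- The basis vector `α` of a triple `(α, C, C')`. -/
def Triple.α {f : std F d ⟶ X} (v : Triple f) : X := imBasis f v.idx

theorem imBasis_ne_zero (f : std F d ⟶ X) (i : Fin d) : imBasis f i ≠ 0 := by
  intro h
  have h' : (Pi.single i (1 : F) : Fin d → F) = 0 :=
    f.injective (h.trans (map_zero f.toLinearMap).symm)
  simpa using congrFun h' i

instance [Finite F] (f : std F d ⟶ X) : Finite (Triple f) := by
  have : Finite X := Module.finite_of_finite F
  have : Finite (Submodule F X) := Finite.of_injective _ (SetLike.coe_injective (A := Submodule F X))
  refine Finite.of_injective (fun v : Triple f => (v.idx, v.C, v.C')) ?_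
  rintro v w h
  simp only [Prod.mk.injEq] at h
  exact Triple.ext h.1 h.2.1 h.2.2

/-- Existence of the coordinate along `α_v` with respect to `X = F α_v + C_v + C'_v`. -/
theorem exists_coord {f : std F d ⟶ X} (v : Triple f) :
    ∃ l : X →ₗ[F] F, l v.α = 1 ∧ (∀ c ∈ v.C, l c = 0) ∧ ∀ c ∈ v.C', l c = 0 := by
  have hα : v.α ∉ v.C ⊔ v.C' := by
    intro h
    obtain ⟨c, hc, c', hc', hs⟩ := Submodule.mem_sup.1 h
    have h1 : v.α ∈ LinearMap.range f.toLinearMap :=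
      v.sup_eq ▸ Submodule.mem_sup_left (Submodule.mem_span_singleton_self _)
    have h2 : c ∈ LinearMap.range f.toLinearMap := v.sup_eq ▸ Submodule.mem_sup_right hc
    have h3 : c' = 0 := by
      refine (Submodule.disjoint_def.1 v.isCompl.disjoint) c' ?_ hc'
      rw [← hs] at h1
      simpa using Submodule.sub_mem _ h1 h2
    rw [h3, add_zero] at hs
    exact imBasis_ne_zero f v.idx ((Submodule.disjoint_def.1 v.disjoint) _
      (Submodule.mem_span_singleton_self _) (show v.α ∈ v.C by rw [← hs]; exact hc))
  obtain ⟨l, hl, hl'⟩ := Submodule.exists_le_ker_of_notMem hα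
  refine ⟨(l v.α)⁻¹ • l, by simp [hl], fun c hc => ?_, fun c hc => ?_⟩
  · have : l c = 0 := hl' (Submodule.mem_sup_left hc)
    simp [this]
  · have : l c = 0 := hl' (Submodule.mem_sup_right hc)
    simp [this]

variable [Finite F]

/-- The vector space freely generated by the triples of `f`. -/
abbrev E (f : std F d ⟶ X) : VI F := ⟨Triple f →₀ F⟩

/-- The basis vector `e_v` of `E f`. -/
def e {f : std F d ⟶ X} (v : Triple f) : E f := (Finsupp.single v (1 : F) : Triple f →₀ F)

/-- A vector of `X`, as a vector of `X + E f`. -/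
def inX (f : std F d ⟶ X) : X →ₗ[F] sum X (E f) := LinearMap.inl F X (E f)

/-- A vector of `E f`, as a vector of `X + E f`. -/
def inE (f : std F d ⟶ X) : E f →ₗ[F] sum X (E f) := LinearMap.inr F X (E f)

/-- The conditions that determine `σ_v`: it takes `α_v` to `e_v`, and fixes `α_w - e_w` for all
triples `w`, all vectors of `C_v` and all vectors of `C'_v`. -/
structure IsSigma {f : std F d ⟶ X} (v : Triple f) (σ : sum X (E f) ≃ₗ[F] sum X (E f)) : Prop where
  map_α : σ (inX f v.α) = inE f (e v)
  map_sub : ∀ w : Triple f, σ (inX f w.α - inE f (e w)) = inX f w.α - inE f (e w)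
  map_C : ∀ c ∈ v.C, σ (inX f c) = inX f c
  map_C' : ∀ c ∈ v.C', σ (inX f c) = inX f c

/-- Linear maps on `X + E f` that agree on `α_v`, `C_v`, `C'_v` and all `α_w - e_w` are equal. -/
theorem linearMap_ext {f : std F d ⟶ X} (v : Triple f) {M : Type*} [AddCommGroup M] [Module F M]
    {p q : sum X (E f) →ₗ[F] M} (hα : p (inX f v.α) = q (inX f v.α))
    (hs : ∀ w : Triple f, p (inX f w.α - inE f (e w)) = q (inX f w.α - inE f (e w)))
    (hC : ∀ c ∈ v.C, p (inX f c) = q (inX f c))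
    (hC' : ∀ c ∈ v.C', p (inX f c) = q (inX f c)) : p = q := by
  have hX : p ∘ₗ inX f = q ∘ₗ inX f := by
    have h1 : v.C ≤ LinearMap.eqLocus (p ∘ₗ inX f) (q ∘ₗ inX f) := hC
    have h2 : v.C' ≤ LinearMap.eqLocus (p ∘ₗ inX f) (q ∘ₗ inX f) := hC'
    have h3 : Submodule.span F {imBasis f v.idx} ≤
        LinearMap.eqLocus (p ∘ₗ inX f) (q ∘ₗ inX f) := by
      rw [Submodule.span_singleton_le_iff_mem]; exact hα
    have h4 := sup_le (v.sup_eq ▸ sup_le h3 h1) h2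
    rw [v.isCompl.sup_eq_top] at h4
    exact LinearMap.ext fun x => h4 (Submodule.mem_top (x := x))
  refine LinearMap.prod_ext hX ?_
  refine Finsupp.lhom_ext' fun w => LinearMap.ext_ring ?_
  have h := hs w
  have hw : p (inX f w.α) = q (inX f w.α) := LinearMap.congr_fun hX w.α
  rw [map_sub, map_sub, hw, sub_right_inj] at h
  exact h

/-- The functional on `X + E f` with value `1` at `α_v` that vanishes on `C_v`, `C'_v` and on all
`α_w - e_w`. -/
theorem exists_coordSum {f : std F d ⟶ X} (v : Triple f) :
    ∃ l : sum X (E f) →ₗ[F] F, l (inX f v.α) = 1 ∧ (∀ w, l (inX f w.α - inE f (e w)) = 0) ∧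
      (∀ c ∈ v.C, l (inX f c) = 0) ∧ ∀ c ∈ v.C', l (inX f c) = 0 := by
  obtain ⟨l, h1, h2, h3⟩ := exists_coord v
  refine ⟨LinearMap.coprod l (l ∘ₗ Finsupp.linearCombination F Triple.α), ?_, fun w => ?_,
    fun c hc => ?_, fun c hc => ?_⟩
  · simpa [inX] using h1
  · rw [map_sub, sub_eq_zero]
    simp [inX, inE, e]
  · simpa [inX] using h2 c hc
  · simpa [inX] using h3 c hc

/-- Any map satisfying the conditions on `σ_v` is the transvection
`x ↦ x + l x • (e_v - α_v)`. -/
theorem IsSigma.apply_eq {f : std F d ⟶ X} {v : Triple f}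
    {σ : sum X (E f) ≃ₗ[F] sum X (E f)} (hσ : IsSigma v σ) {l : sum X (E f) →ₗ[F] F}
    (h1 : l (inX f v.α) = 1) (h2 : ∀ w, l (inX f w.α - inE f (e w)) = 0)
    (h3 : ∀ c ∈ v.C, l (inX f c) = 0) (h4 : ∀ c ∈ v.C', l (inX f c) = 0) (x : sum X (E f)) :
    σ x = x + l x • (inE f (e v) - inX f v.α) := by
  have : (σ : sum X (E f) →ₗ[F] sum X (E f)) =
      LinearMap.id + l.smulRight (inE f (e v) - inX f v.α) := by
    refine linearMap_ext v ?_ ?_ ?_ ?_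
    · simp [h1, hσ.map_α]
    · intro w
      simp only [LinearEquiv.coe_coe, hσ.map_sub w, LinearMap.add_apply, LinearMap.id_apply,
        LinearMap.smulRight_apply, h2 w, zero_smul, add_zero]
    · intro c hc; simp [h3 c hc, hσ.map_C c hc]
    · intro c hc; simp [h4 c hc, hσ.map_C' c hc]
  exact LinearMap.congr_fun this x

theorem existsUnique_isSigma {f : std F d ⟶ X} (v : Triple f) : ∃! σ, IsSigma v σ := by
  obtain ⟨l, h1, h2, h3, h4⟩ := exists_coordSum v
  set t : sum X (E f) := inE f (e v) - inX f v.α with ht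
  have hlt : l t = 0 := by
    rw [ht, ← neg_sub, map_neg, h2 v, neg_zero]
  refine ⟨LinearEquiv.ofLinearMap (LinearMap.id + l.smulRight t) (LinearMap.id - l.smulRight t)
    ?_ ?_, ⟨?_, ?_, ?_, ?_⟩, fun τ hτ => ?_⟩
  · refine LinearMap.ext fun x => ?_
    simp [hlt]
  · refine LinearMap.ext fun x => ?_
    simp [hlt]
  · simp [h1, ht]
  · intro w
    simp only [LinearEquiv.coe_ofLinearMap, LinearMap.add_apply, LinearMap.id_apply,
        LinearMap.smulRight_apply, h2 w, zero_smul, add_zero]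
  · intro c hc; simp [h3 c hc]
  · intro c hc; simp [h4 c hc]
  · exact LinearEquiv.ext fun x => by simp [hτ.apply_eq h1 h2 h3 h4 x, ht]

/-- The automorphism `σ_v` of `X + E f`. -/
def sigma {f : std F d ⟶ X} (v : Triple f) : sum X (E f) ≃ₗ[F] sum X (E f) :=
  (existsUnique_isSigma v).choose

theorem sigma_spec {f : std F d ⟶ X} (v : Triple f) : IsSigma v (sigma v) :=
  (existsUnique_isSigma v).choose_spec.1

theorem sigma_comm {f : std F d ⟶ X} (v w : Triple f) (x : sum X (E f)) :
    sigma v (sigma w x) = sigma w (sigma v x) := by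
  obtain ⟨l, h1, h2, h3, h4⟩ := exists_coordSum v
  obtain ⟨m, k1, k2, k3, k4⟩ := exists_coordSum w
  have hl : l (inE f (e w) - inX f w.α) = 0 := by rw [← neg_sub, map_neg, h2 w, neg_zero]
  have hm : m (inE f (e v) - inX f v.α) = 0 := by rw [← neg_sub, map_neg, k2 v, neg_zero]
  simp only [(sigma_spec v).apply_eq h1 h2 h3 h4, (sigma_spec w).apply_eq k1 k2 k3 k4,
    map_add, map_smul, hl, hm, smul_zero, add_zero]
  abel

end Triples

end VI

/-! ## `VI`-modules, torsion, and the generic category -/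

/-- `VI`-modules over `k`. -/
abbrev VIMod (F : Type u) [Field F] (k : Type u) [Field k] : Type (u + 1) :=
  VI F ⥤ ModuleCat.{u} k

namespace VIMod

variable {F : Type u} [Field F] {k : Type u} [Field k]

variable (F k) in
/-- A `VI`-module is torsion if each of its elements is killed by some morphism of `VI`. -/
def IsTorsion : ObjectProperty (VIMod F k) := fun M =>
  ∀ (X : VI F) (x : M.obj X), ∃ (Y : VI F) (g : X ⟶ Y), M.map g x = 0

instance : (IsTorsion F k).IsSerreClass where
  exists_zero := by
    obtain ⟨Z, hZ⟩ := HasZeroObject.zero (C := VIMod F k)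
    refine ⟨Z, hZ, fun X x => ⟨X, 𝟙 X, ?_⟩⟩
    have h : IsZero (Z.obj X) :=
      ((evaluation (VI F) (ModuleCat.{u} k)).obj X).map_isZero hZ
    have := ModuleCat.subsingleton_of_isZero h
    exact Subsingleton.elim _ _
  prop_of_mono {M N} i _ hN X x := by
    obtain ⟨Y, g, hg⟩ := hN X (i.app X x)
    refine ⟨Y, g, (ModuleCat.mono_iff_injective (i.app Y)).1 inferInstance ?_⟩
    rw [map_zero, ← hg]
    exact NatTrans.naturality_apply i g x
  prop_of_epi {M N} p _ hM X x := by
    obtain ⟨x, rfl⟩ := (ModuleCat.epi_iff_surjective (p.app X)).1 inferInstance x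
    obtain ⟨Y, g, hg⟩ := hM X x
    refine ⟨Y, g, ?_⟩
    rw [← NatTrans.naturality_apply p g x, hg, map_zero]
  prop_X₂_of_shortExact {S} hS h₁ h₃ X x := by
    obtain ⟨Y, g, hg⟩ := h₃ X (S.g.app X x)
    rw [← NatTrans.naturality_apply S.g g x] at hg
    have hex := hS.exact.map ((evaluation (VI F) (ModuleCat.{u} k)).obj Y)
    rw [ShortComplex.moduleCat_exact_iff] at hex
    obtain ⟨y, hy⟩ := hex (S.X₂.map g x) hg
    obtain ⟨Z, h, hh⟩ := h₁ Y y
    refine ⟨Z, g ≫ h, ?_⟩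
    have hy' : S.f.app Y y = S.X₂.map g x := hy
    have := NatTrans.naturality_apply S.f h y
    rw [hh, map_zero, hy'] at this
    rw [S.X₂.map_comp, ModuleCat.comp_apply]
    exact this.symm

variable (F k) in
/-- The category of generic `VI`-modules: the Serre quotient of the category of `VI`-modules by the
subcategory of torsion modules. -/
abbrev Generic := (IsTorsion F k).isoModSerre.Localization

variable (F k) in
/-- The localization functor `T` to the generic category. -/
abbrev T : VIMod F k ⥤ Generic F k := (IsTorsion F k).isoModSerre.Q

instance : (T F k).PreservesMonomorphisms :=
  ObjectProperty.SerreClassLocalization.preservesMonomorphisms _ (IsTorsion F k)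

/-! ### Submodules -/

/-- A `VI`-submodule of a `VI`-module. -/
@[ext]
structure Sub (M : VIMod F k) where
  carrier (X : VI F) : Submodule k (M.obj X)
  map_mem {X Y : VI F} (g : X ⟶ Y) {x : M.obj X} (hx : x ∈ carrier X) : M.map g x ∈ carrier Y

/-- A submodule, as a `VI`-module. -/
def Sub.toMod {M : VIMod F k} (N : Sub M) : VIMod F k where
  obj X := ModuleCat.of k (N.carrier X)
  map g := ModuleCat.ofHom ((M.map g).hom.restrict fun _ hx => N.map_mem g hx)
  map_id X := by
    refine ModuleCat.hom_ext (LinearMap.ext fun x => Subtype.ext ?_)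
    exact congrArg (fun φ => φ.hom x.1) (M.map_id X)
  map_comp f g := by
    refine ModuleCat.hom_ext (LinearMap.ext fun x => Subtype.ext ?_)
    exact congrArg (fun φ => φ.hom x.1) (M.map_comp f g)

/-- The inclusion of a submodule. -/
def Sub.incl {M : VIMod F k} (N : Sub M) : N.toMod ⟶ M where
  app X := ModuleCat.ofHom (N.carrier X).subtype
  naturality _ _ _ := rfl

instance {M : VIMod F k} (N : Sub M) : Mono N.incl := by
  have (X : VI F) : Mono (N.incl.app X) :=
    (ModuleCat.mono_iff_injective _).2 (N.carrier X).injective_subtype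
  exact NatTrans.mono_of_mono_app _

/-- The submodule of `M` generated by a set `S` of elements of `M(X)`. -/
def Sub.generate (M : VIMod F k) (X : VI F) (S : Set (M.obj X)) : Sub M where
  carrier Y := Submodule.span k {y | ∃ g : X ⟶ Y, ∃ s ∈ S, y = M.map g s}
  map_mem {Y Z} g x hx := by
    refine (Submodule.span_le.2 ?_ : _ ≤ (Submodule.span k _).comap (M.map g).hom) hx
    rintro _ ⟨h, s, hs, rfl⟩
    exact Submodule.subset_span ⟨h ≫ g, s, hs, by simp⟩

/-! ### Induced modules -/

section Induced

variable {d : ℕ} {Θ : Type u} [AddCommGroup Θ] [Module k Θ]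
  (ρ : Representation k (LinearMap.GeneralLinearGroup F (Fin d → F)) Θ)

/-- `k[Hom(F ^ d, X)] ⊗_k Θ` is realized as the direct sum of copies of `Θ` indexed by
`Hom(F ^ d, X)`, with `[f] ⊗ θ` being `Finsupp.single f θ`. These are the relations
`[f ∘ σ] ⊗ θ = [f] ⊗ σ θ` that define the tensor product over `GL_d` as a quotient of the tensor
product over `k`. -/
def relations (X : VI F) : Submodule k ((VI.std F d ⟶ X) →₀ Θ) :=
  Submodule.span k {z | ∃ (f : VI.std F d ⟶ X)
    (σ : LinearMap.GeneralLinearGroup F (Fin d → F)) (θ : Θ),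
    z = Finsupp.single (VI.ofGL σ ≫ f) θ - Finsupp.single f (ρ σ θ)}

/-- The map `[f] ⊗ θ ↦ [g ∘ f] ⊗ θ` induced on `k[Hom(F ^ d, X)] ⊗_k Θ` by `g : X ⟶ Y`. -/
def preMap {X Y : VI F} (g : X ⟶ Y) :
    ((VI.std F d ⟶ X) →₀ Θ) →ₗ[k] ((VI.std F d ⟶ Y) →₀ Θ) :=
  Finsupp.lmapDomain Θ k (fun f : VI.std F d ⟶ X => f ≫ g)

theorem preMap_mem {X Y : VI F} (g : X ⟶ Y) :
    relations ρ X ≤ (relations ρ Y).comap (preMap g) := by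
  refine Submodule.span_le.2 ?_
  rintro _ ⟨f, σ, θ, rfl⟩
  exact Submodule.subset_span ⟨f ≫ g, σ, θ, by
    rw [map_sub]
    simp [preMap, Finsupp.mapDomain_single]⟩

/-- The induced `VI`-module `k[Hom(F ^ d, -)] ⊗_{GL_d} Θ`. -/
def induced : VIMod F k where
  obj X := ModuleCat.of k (((VI.std F d ⟶ X) →₀ Θ) ⧸ relations ρ X)
  map {X Y} g := ModuleCat.ofHom ((relations ρ X).mapQ (relations ρ Y) (preMap g) (preMap_mem ρ g))
  map_id X := by
    have h : preMap (k := k) (d := d) (Θ := Θ) (𝟙 X) = LinearMap.id := by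
      ext; simp [preMap, Finsupp.mapDomain_single]
    ext1
    refine Submodule.linearMap_qext _ (LinearMap.ext fun x => ?_)
    simp [h]
  map_comp {X Y Z} f g := by
    have h : preMap (k := k) (d := d) (Θ := Θ) (f ≫ g) = preMap g ∘ₗ preMap f := by
      ext; simp [preMap, Finsupp.mapDomain_single]
    ext1
    refine Submodule.linearMap_qext _ (LinearMap.ext fun x => ?_)
    simp [h]

/-- The element `[f] ⊗ θ` of the induced module. -/
def tmul {X : VI F} (f : VI.std F d ⟶ X) (θ : Θ) : (induced ρ).obj X :=
  (relations ρ X).mkQ (Finsupp.single f θ)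

end Induced

/-! ### The operators `L` and the submodules `M_{n, Θ}` -/

section Main

variable [Finite F] {d : ℕ}

/-- The action of `σ_v` on `M(X + E f)`. -/
def sigmaEnd (M : VIMod F k) {X : VI F} {f : VI.std F d ⟶ X} (v : VI.Triple f) :
    Module.End k (M.obj (VI.sum X (VI.E f))) :=
  (M.map (VI.ofEquiv (VI.sigma v))).hom

theorem sigmaEnd_commute (M : VIMod F k) {X : VI F} {f : VI.std F d ⟶ X} (v w : VI.Triple f) :
    Commute (sigmaEnd M v) (sigmaEnd M w) := by
  have h : VI.ofEquiv (VI.sigma v) ≫ VI.ofEquiv (VI.sigma w) =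
      VI.ofEquiv (VI.sigma w) ≫ VI.ofEquiv (VI.sigma v) := by
    ext1
    exact LinearMap.ext fun x => VI.sigma_comm w v x
  have h' := congrArg (fun g => (M.map g).hom) h
  simp only [Functor.map_comp, ModuleCat.hom_comp] at h'
  exact h'.symm

open scoped Classical in
/-- The operator `L = ∏_v (id - σ_v)` on `M(X + E f)`, the product being over all triples `v` of
`f`. The factors commute, so that no order has to be chosen. -/
def opL (M : VIMod F k) {X : VI F} (f : VI.std F d ⟶ X) :
    Module.End k (M.obj (VI.sum X (VI.E f))) :=
  letI : Fintype (VI.Triple f) := Fintype.ofFinite _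
  (Finset.univ : Finset (VI.Triple f)).noncommProd (fun v => 1 - sigmaEnd M v)
    fun v _ w _ _ => ((Commute.one_left _).sub_left
      ((Commute.one_right _).sub_right (sigmaEnd_commute M v w)))

variable {Θ : Type u} [AddCommGroup Θ] [Module k Θ]

/-- The submodule `M_{n, Θ}` of the induced module, generated by the elements
`L ([f ^ E] ⊗ θ)`, where `f : F ^ d ⟶ F ^ n` is the natural inclusion and `θ` runs through `Θ`. -/
def subM (ρ : Representation k (LinearMap.GeneralLinearGroup F (Fin d → F)) Θ) {n : ℕ}
    (h : d ≤ n) : Sub (induced ρ) :=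
  Sub.generate (induced ρ) (VI.sum (VI.std F n) (VI.E (VI.stdIncl h)))
    (Set.range fun θ : Θ =>
      opL (induced ρ) (VI.stdIncl h) (tmul ρ (VI.extend (VI.stdIncl h) (VI.E (VI.stdIncl h))) θ))

end Main

end VIMod

/-- `S` is the socle of the object `X`: the join of all the simple subobjects of `X`. -/
def IsSocle {C : Type*} [Category C] [HasZeroMorphisms C] {X : C} (S : Subobject X) : Prop :=
  IsLUB {A : Subobject X | Simple (A : C)} S

end

/-! Everything follows from one minimality statement: a saturated nonzero submodule `N` of the
induced module contains $M_{n,\Theta}$ (`subM_le`). Hence $T(M_{n,\Theta})$ lies in every nonzero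
subobject of $T(\mathcal I(\Theta))$ (`mk_map_incl_le`). It is itself nonzero, and a nonzero
subobject lying below all nonzero subobjects is simple and is the only simple one, so it is the
socle.

For the minimality, take $0\ne x\in N(X)$. An element of $\mathcal I(\Theta)(X)$ is determined by
its components in $\Theta$, one for each $d$-dimensional subspace of $X$ once a frame is chosen, so
$x$ has a nonzero component $\theta$ at some $f$. The operator $L$ of $f$ annihilates every
$[g]\otimes\theta'$ with $\mathrm{im}\,g\ne\mathrm{im}\,f$: some triple has a coordinate vanishing
on $\mathrm{im}\,g$, and its $\sigma_v$ fixes $[g]$. So $L$ isolates $L([f]\otimes\theta)\in N$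
(`opL_map_inl`).

After the change of coordinates `embed`, this element is the image of a product of factors $1-s_v$
applied to $[\mathrm{id}]\otimes\theta$, where $s_v$ is the shear $a\mapsto a+\varphi_v(a)e_v$ of
$\mathbb F^d\oplus\mathcal E$ (`opL_tmul`). Saturation allows `embed` to be cancelled. The
$\varphi_v$ run, with repetitions, through all functionals whose first nonzero coefficient is $1$;
only the repetitions depend on $f$. Membership in a saturated submodule is insensitive to them
(`act_shearProd_mem_of_range`), and this is where invertibility of $q$ enters. Thus $f$ may be
replaced by the standard inclusion, and irreducibility of $\Theta$ upgrades the single $\theta$ to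
all of $\Theta$. -/

noncomputable section

namespace VI

variable {F : Type u} [Field F]

/-! ### Shears of a direct sum -/

/-- The inclusion of the first summand. -/
def inl (A B : VI F) : A ⟶ sum A B := ⟨LinearMap.inl F A B, LinearMap.inl_injective⟩

/-- The automorphism `(a, b) ↦ (a, b + h a)` of `A + B`. -/
def shear {A B : VI F} (h : A →ₗ[F] B) : sum A B ⟶ sum A B where
  toLinearMap := (LinearMap.fst F A B).prod (LinearMap.snd F A B + h ∘ₗ LinearMap.fst F A B)
  injective := by
    intro x y hxy
    have hxy : (x.1, x.2 + h x.1) = (y.1, y.2 + h y.1) := hxy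
    obtain ⟨h1, h2⟩ := Prod.mk.inj hxy
    rw [h1] at h2
    exact Prod.ext h1 (add_right_cancel h2)

theorem shear_zero {A B : VI F} : shear (0 : A →ₗ[F] B) = 𝟙 (sum A B) :=
  hom_ext (LinearMap.ext fun x => Prod.ext rfl (add_zero x.2))

theorem shear_comp {A B : VI F} (h h' : A →ₗ[F] B) : shear h ≫ shear h' = shear (h + h') :=
  hom_ext (LinearMap.ext fun x => Prod.ext rfl (add_assoc x.2 (h x.1) (h' x.1)))

/-- The morphism `id + g` of direct sums. -/
def mapRight (A : VI F) {B B' : VI F} (g : B ⟶ B') : sum A B ⟶ sum A B' :=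
  ⟨LinearMap.id.prodMap g.toLinearMap, Function.injective_id.prodMap g.injective⟩

theorem inl_mapRight (A : VI F) {B B' : VI F} (g : B ⟶ B') :
    inl A B ≫ mapRight A g = inl A B' :=
  hom_ext (LinearMap.ext fun x => by simp [inl, mapRight])

theorem shear_mapRight {A B B' : VI F} (g : B ⟶ B') (h : A →ₗ[F] B) :
    shear h ≫ mapRight A g = mapRight A g ≫ shear (g.toLinearMap ∘ₗ h) :=
  hom_ext (LinearMap.ext fun x => by simp [shear, mapRight])

theorem exists_amalgam {X Y Z : VI F} (g : X ⟶ Y) (h : X ⟶ Z) :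
    ∃ (W : VI F) (g' : Y ⟶ W) (h' : Z ⟶ W), g ≫ g' = h ≫ h' := by
  obtain ⟨r, hr⟩ := h.toLinearMap.exists_leftInverse_of_injective (LinearMap.ker_eq_bot.2 h.injective)
  have hr' (x : X) : r (h.toLinearMap x) = x := LinearMap.congr_fun hr x
  -- With `r` a retraction of `h`, `Z` goes to `Y + Z` by `g ∘ r` plus the projection `1 - h ∘ r`.
  -- The second part vanishes on the image of `h` and the first is injective there.
  refine ⟨sum Y Z, inl Y Z,
    ⟨(g.toLinearMap ∘ₗ r).prod (LinearMap.id - h.toLinearMap ∘ₗ r), ?_⟩, ?_⟩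
  · refine (injective_iff_map_eq_zero _).2 fun z hz => ?_
    have h1 : g.toLinearMap (r z) = 0 := congrArg Prod.fst hz
    have h2 : z - h.toLinearMap (r z) = 0 := congrArg Prod.snd hz
    have : r z = 0 := g.injective (by rw [h1, map_zero])
    simpa [this] using h2
  · exact hom_ext (LinearMap.ext fun x => by simp [inl, hr'])

/-! ### Coordinate functionals of triples -/

section Triples

variable {d : ℕ} {X : VI F} {f : std F d ⟶ X}

/-- The coordinate along `α_v` with respect to `X = F α_v + C_v + C'_v`. -/
def Triple.coord (v : Triple f) : X →ₗ[F] F := (exists_coord v).choose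

theorem Triple.coord_α (v : Triple f) : v.coord v.α = 1 := (exists_coord v).choose_spec.1

theorem Triple.coord_C (v : Triple f) {c : X} (hc : c ∈ v.C) : v.coord c = 0 :=
  (exists_coord v).choose_spec.2.1 c hc

theorem Triple.coord_C' (v : Triple f) {c : X} (hc : c ∈ v.C') : v.coord c = 0 :=
  (exists_coord v).choose_spec.2.2 c hc

/-- The restriction of the coordinate functional along `f`. -/
def Triple.functional (v : Triple f) : (Fin d → F) →ₗ[F] F := v.coord ∘ₗ f.toLinearMap

/-- Functionals whose first nonzero coefficient is `1`. -/
def IsNormalized (φ : (Fin d → F) →ₗ[F] F) : Prop :=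
  ∃ i, φ (Pi.single i 1) = 1 ∧ ∀ j < i, φ (Pi.single j 1) = 0

theorem IsNormalized.ne_zero {φ : (Fin d → F) →ₗ[F] F} (h : IsNormalized φ) : φ ≠ 0 := by
  rintro rfl
  obtain ⟨i, hi, -⟩ := h
  simp at hi

theorem exists_smul_isNormalized {φ : (Fin d → F) →ₗ[F] F} (h : φ ≠ 0) :
    ∃ c : F, c ≠ 0 ∧ IsNormalized (c • φ) := by
  classical
  have hex : ∃ i, φ (Pi.single i 1) ≠ 0 := by
    by_contra! hc
    refine h (LinearMap.pi_ext' fun i => LinearMap.ext_ring ?_)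
    simpa using hc i
  obtain ⟨i, hi, hmin⟩ := WellFounded.has_min (wellFounded_lt (α := Fin d))
    {i | φ (Pi.single i 1) ≠ 0} hex
  refine ⟨(φ (Pi.single i 1))⁻¹, inv_ne_zero hi, i, by simpa using inv_mul_cancel₀ hi, fun j hj => ?_⟩
  have : φ (Pi.single j 1) = 0 := by
    by_contra hj'
    exact hmin j hj' hj
  simp [this]

theorem Triple.isNormalized (v : Triple f) : IsNormalized v.functional :=
  ⟨v.idx, v.coord_α, fun j hj => v.coord_C (v.lower_mem j hj)⟩

/-- Take `α` at the first index where `l` is nonzero and `C = W ⊓ ker l`, which contains the earlier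
basis vectors. Since `l` is nonzero on `W`, a complement of `C` inside `ker l` is a complement of
`W` in `X`. -/
theorem exists_coord_eq (l : X →ₗ[F] F) (hl : IsNormalized (l ∘ₗ f.toLinearMap)) :
    ∃ v : Triple f, v.coord = l := by
  obtain ⟨i, hi, hlow⟩ := hl
  have hi' : l (imBasis f i) = 1 := hi
  set W := LinearMap.range f.toLinearMap with hW
  have hα : imBasis f i ∈ W := ⟨_, rfl⟩
  obtain ⟨D, hD⟩ := Submodule.exists_isCompl (W.comap (LinearMap.ker l).subtype)
  have hker {x : X} (hx : l x = 0) : ∃ w ∈ W, l w = 0 ∧ ∃ c ∈ D, w + c = x := by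
    have hx' : (⟨x, hx⟩ : LinearMap.ker l) ∈ W.comap (LinearMap.ker l).subtype ⊔ D := by
      rw [hD.sup_eq_top]; trivial
    obtain ⟨w, hw, c, hc, hs⟩ := Submodule.mem_sup.1 hx'
    exact ⟨w, hw, w.2, c, hc, congrArg Subtype.val hs⟩
  let v : Triple f :=
    { idx := i
      C := W ⊓ LinearMap.ker l
      C' := D.map (LinearMap.ker l).subtype
      disjoint := by
        rw [Submodule.disjoint_def]
        rintro x hx ⟨-, hx'⟩
        obtain ⟨c, rfl⟩ := Submodule.mem_span_singleton.1 hx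
        have : c = 0 := by simpa [hi'] using hx'
        simp [this]
      sup_eq := by
        refine le_antisymm (sup_le ((Submodule.span_singleton_le_iff_mem _ _).2 hα) inf_le_left)
          fun x hx => ?_
        refine Submodule.mem_sup.2 ⟨l x • imBasis f i,
          Submodule.smul_mem _ _ (Submodule.mem_span_singleton_self _), x - l x • imBasis f i,
          ⟨W.sub_mem hx (W.smul_mem _ hα), by simp [hi']⟩, by simp⟩
      lower_mem := fun j hj => ⟨⟨_, rfl⟩, hlow j hj⟩
      isCompl := by
        constructor
        · rw [Submodule.disjoint_def]
          rintro _ hx ⟨c, hc, rfl⟩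
          have := (Submodule.disjoint_def.1 hD.disjoint) c hx hc
          simp [this]
        · rw [codisjoint_iff, eq_top_iff]
          rintro x -
          obtain ⟨w, hw, -, c, hc, hs⟩ := hker (x := x - l x • imBasis f i) (by simp [hi'])
          refine Submodule.mem_sup.2 ⟨w + l x • imBasis f i, W.add_mem hw (W.smul_mem _ hα), c,
            ⟨c, hc, rfl⟩, ?_⟩
          rw [add_right_comm, hs, sub_add_cancel] }
  refine ⟨v, LinearMap.ext fun x => ?_⟩
  obtain ⟨w, hw, hlw, c, hc, hs⟩ := hker (x := x - l x • imBasis f i) (by simp [hi'])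
  have h1 : v.coord w = 0 := v.coord_C ⟨hw, hlw⟩
  have h2 : v.coord c = 0 := v.coord_C' ⟨c, hc, rfl⟩
  have h3 : v.coord (imBasis f i) = 1 := v.coord_α
  have := congrArg v.coord hs
  rw [map_add, h1, h2, map_sub, map_smul, h3] at this
  simpa [sub_eq_zero] using this.symm

theorem exists_functional_eq (f : std F d ⟶ X) {φ : (Fin d → F) →ₗ[F] F} (hφ : IsNormalized φ) :
    ∃ v : Triple f, v.functional = φ := by
  obtain ⟨r, hr⟩ := f.toLinearMap.exists_leftInverse_of_injective (LinearMap.ker_eq_bot.2 f.injective)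
  have h : (φ ∘ₗ r) ∘ₗ f.toLinearMap = φ := by rw [LinearMap.comp_assoc, hr, LinearMap.comp_id]
  obtain ⟨v, hv⟩ := exists_coord_eq (φ ∘ₗ r) (h.symm ▸ hφ)
  exact ⟨v, by rw [Triple.functional, hv, h]⟩

/-- Some functional vanishes on the image of `g` but not on that of `f`; rescaled, it is a
coordinate by `exists_coord_eq`. -/
theorem exists_coord_comp_eq_zero {g : std F d ⟶ X}
    (h : ¬ LinearMap.range f.toLinearMap ≤ LinearMap.range g.toLinearMap) :
    ∃ v : Triple f, v.coord ∘ₗ g.toLinearMap = 0 := by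
  obtain ⟨x, ⟨a, rfl⟩, hx⟩ := SetLike.not_le_iff_exists.1 h
  obtain ⟨l, hl, hl'⟩ := Submodule.exists_le_ker_of_notMem hx
  obtain ⟨c, -, hn⟩ := exists_smul_isNormalized (φ := l ∘ₗ f.toLinearMap)
    fun h0 => hl (LinearMap.congr_fun h0 a)
  obtain ⟨v, hv⟩ := exists_coord_eq (f := f) (c • l) (by rwa [LinearMap.smul_comp])
  refine ⟨v, LinearMap.ext fun y => ?_⟩
  have : l (g.toLinearMap y) = 0 := hl' ⟨y, rfl⟩
  simp [hv, this]

/-- Morphisms `F ^ d ⟶ X` with nested images differ by an element of `GL_d`. -/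
theorem exists_ofGL_comp {g : std F d ⟶ X}
    (h : LinearMap.range f.toLinearMap ≤ LinearMap.range g.toLinearMap) :
    ∃ σ, ofGL σ ≫ g = f := by
  obtain ⟨r, hr⟩ := g.toLinearMap.exists_leftInverse_of_injective (LinearMap.ker_eq_bot.2 g.injective)
  have hgr (x : Fin d → F) : g.toLinearMap (r (f.toLinearMap x)) = f.toLinearMap x := by
    obtain ⟨y, hy⟩ := h ⟨x, rfl⟩
    rw [← hy]
    exact congrArg _ (LinearMap.congr_fun hr y)
  have hinj : Function.Injective (r ∘ₗ f.toLinearMap) := fun x y hxy =>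
    f.injective (by rw [← hgr x, ← hgr y]; exact congrArg _ hxy)
  refine ⟨LinearMap.GeneralLinearGroup.ofLinearEquiv
    (LinearEquiv.ofInjectiveEndo (r ∘ₗ f.toLinearMap) hinj), hom_ext (LinearMap.ext hgr)⟩

variable [Finite F]

theorem sigma_apply (v : Triple f) (x : sum X (E f)) :
    sigma v x = x + (v.coord x.1 + v.coord (Finsupp.linearCombination F Triple.α x.2)) •
      (inE f (e v) - inX f v.α) := by
  rw [(sigma_spec v).apply_eq
    (l := LinearMap.coprod v.coord (v.coord ∘ₗ Finsupp.linearCombination F Triple.α))]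
  · simp
  · simp [inX, v.coord_α]
  · intro w
    rw [map_sub, sub_eq_zero]
    simp [inX, inE, e]
  · intro c hc
    simp [inX, v.coord_C hc]
  · intro c hc
    simp [inX, v.coord_C' hc]

/-- The morphism `F ^ d + E f ⟶ X + E f` that is `f` on `F ^ d` and takes `e_v` to `e_v - α_v`. -/
def embed (f : std F d ⟶ X) : sum (std F d) (E f) ⟶ sum X (E f) where
  toLinearMap := (LinearMap.coprod f.toLinearMap (-Finsupp.linearCombination F Triple.α)).prod
    (LinearMap.snd F _ _)
  injective := by
    refine (injective_iff_map_eq_zero _).2 fun x hx => ?_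
    have h1 : f.toLinearMap x.1 + -Finsupp.linearCombination F Triple.α x.2 = 0 :=
      congrArg Prod.fst hx
    have h2 : x.2 = 0 := congrArg Prod.snd hx
    rw [h2, map_zero, neg_zero, add_zero] at h1
    exact Prod.ext (f.injective (h1.trans (map_zero _).symm)) h2

theorem embed_apply (f : std F d ⟶ X) (x : sum (std F d) (E f)) :
    (embed f).toLinearMap x =
      (f.toLinearMap x.1 - Finsupp.linearCombination F Triple.α x.2, x.2) :=
  Prod.ext (sub_eq_add_neg _ _).symm rfl

theorem inl_embed (f : std F d ⟶ X) : inl (std F d) (E f) ≫ embed f = extend f (E f) :=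
  hom_ext (LinearMap.ext fun x => (embed_apply f _).trans (Prod.ext (by simp [inl, extend]) rfl))

/-- All the vectors `e_w - α_w` are fixed by `σ_v`, so in the coordinates of `embed` only the `F ^
d` part is moved, along `e_v`. -/
theorem shear_embed (v : Triple f) :
    shear (A := std F d) (v.functional.smulRight (e v)) ≫ embed f =
      embed f ≫ ofEquiv (sigma v) := by
  refine hom_ext (LinearMap.ext fun x => ?_)
  refine ((embed_apply f _).trans ?_).trans
    ((sigma_apply v _).trans (by rw [embed_apply f x])).symm
  refine Prod.ext ?_ ?_
  · simp [shear, e, inE, inX, Triple.functional]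
    abel
  · simp [shear, e, inE, inX, Triple.functional]

end Triples

end VI

/-! ### Elements of order dividing `q` when `q` is invertible -/

/-- The sum of the `x ^ i`, `i < q`, is annihilated by `1 - x` and is congruent to `q` modulo `1 -
x`. Multiplying that congruence by `1 - x` puts `q * (1 - x)` in the ideal of `(1 - x) ^ 2`. -/
theorem exists_one_sub_eq_mul_sq {k R : Type*} [Field k] [CommRing R] [Algebra k R] {q : ℕ}
    (hq : (q : k) ≠ 0) {x : R} (hx : x ^ q = 1) : ∃ s : R, 1 - x = s * (1 - x) ^ 2 := by
  have h1 : (1 - x) * ∑ i ∈ Finset.range q, x ^ i = 0 := by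
    rw [mul_neg_geom_sum, hx, sub_self]
  obtain ⟨s, hs⟩ : (1 - x) ∣ ∑ i ∈ Finset.range q, (1 - x ^ i) :=
    Finset.dvd_sum fun i _ => one_sub_dvd_one_sub_pow x i
  rw [Finset.sum_sub_distrib, Finset.sum_const, Finset.card_range, nsmul_one] at hs
  have h2 : algebraMap k R (q : k)⁻¹ * (q : R) = 1 := by
    rw [← map_natCast (algebraMap k R), ← map_mul, inv_mul_cancel₀ hq, map_one]
  refine ⟨algebraMap k R (q : k)⁻¹ * s, ?_⟩
  linear_combination (-(1 - x)) * h2 + algebraMap k R (q : k)⁻¹ * (1 - x) * hs +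
    algebraMap k R (q : k)⁻¹ * h1

namespace VIMod

variable {F : Type u} [Field F] {k : Type u} [Field k]

theorem map_comp_apply (M : VIMod F k) {X Y Z : VI F} (f : X ⟶ Y) (g : Y ⟶ Z) (x : M.obj X) :
    M.map g (M.map f x) = M.map (f ≫ g) x := by
  rw [M.map_comp, ModuleCat.comp_apply]

theorem map_id_apply (M : VIMod F k) {X : VI F} (x : M.obj X) : M.map (𝟙 X) x = x := by
  rw [M.map_id, ModuleCat.id_apply]

/-! ### Saturated submodules -/

/-- A submodule is saturated if the quotient by it is torsion-free. -/
def Sub.IsSaturated {M : VIMod F k} (N : Sub M) : Prop :=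
  ∀ ⦃X Y : VI F⦄ (g : X ⟶ Y) (x : M.obj X), M.map g x ∈ N.carrier Y → x ∈ N.carrier X

/-- The saturation of a submodule. -/
def Sub.saturation {M : VIMod F k} (N : Sub M) : Sub M where
  carrier X :=
    { carrier := {x | ∃ (Y : VI F) (g : X ⟶ Y), M.map g x ∈ N.carrier Y}
      zero_mem' := ⟨X, 𝟙 X, by rw [map_zero]; exact zero_mem _⟩
      smul_mem' := fun c x ⟨Y, g, hg⟩ => ⟨Y, g, by rw [map_smul]; exact Submodule.smul_mem _ c hg⟩
      add_mem' := by
        rintro x y ⟨Y, g, hg⟩ ⟨Z, h, hh⟩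
        obtain ⟨W, g', h', e⟩ := VI.exists_amalgam g h
        refine ⟨W, g ≫ g', ?_⟩
        rw [map_add]
        refine add_mem ?_ ?_
        · rw [← map_comp_apply]; exact N.map_mem g' hg
        · rw [e, ← map_comp_apply]; exact N.map_mem h' hh }
  map_mem := by
    rintro X Z h x ⟨Y, g, hg⟩
    obtain ⟨W, g', h', e⟩ := VI.exists_amalgam g h
    refine ⟨W, h', ?_⟩
    rw [map_comp_apply, ← e, ← map_comp_apply]
    exact N.map_mem g' hg

theorem Sub.saturation_isSaturated {M : VIMod F k} (N : Sub M) : N.saturation.IsSaturated := by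
  rintro X Y g x ⟨Z, h, hh⟩
  exact ⟨Z, g ≫ h, by rwa [← map_comp_apply]⟩

theorem Sub.le_saturation {M : VIMod F k} (N : Sub M) (X : VI F) :
    N.carrier X ≤ N.saturation.carrier X :=
  fun x hx => ⟨X, 𝟙 X, by rwa [map_id_apply]⟩

/-! ### The action of the group algebra of the group of shears -/

/-- The shears of `A + B`, as a group acting on `M (A + B)`. -/
def shearHom (M : VIMod F k) (A B : VI F) :
    Multiplicative (A →ₗ[F] B) →* Module.End k (M.obj (VI.sum A B)) where
  toFun h := (M.map (VI.shear h.toAdd)).hom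
  map_one' := by
    rw [toAdd_one, VI.shear_zero, M.map_id]; rfl
  map_mul' g h := by
    -- Composition in `Module.End` runs opposite to `≫`; the swap is harmless because shears
    -- commute.
    rw [mul_comm, toAdd_mul, ← VI.shear_comp, M.map_comp]; rfl

/-- The group algebra of the group of shears of `A + B`. -/
abbrev ShearAlg (k : Type u) [Field k] (A B : VI F) : Type u :=
  MonoidAlgebra k (Multiplicative (A →ₗ[F] B))

/-- A shear, as an element of the group algebra. -/
def shearOf (k : Type u) [Field k] {A B : VI F} (h : A →ₗ[F] B) : ShearAlg k A B :=
  MonoidAlgebra.of k _ (Multiplicative.ofAdd h)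

theorem shearOf_add {A B : VI F} (h h' : A →ₗ[F] B) :
    shearOf k (h + h') = shearOf k h * shearOf k h' := by
  rw [shearOf, ofAdd_add, map_mul]; rfl

/-- For infinite `F` this rests on the convention `Nat.card F = 0`. -/
theorem natCast_card_eq_zero (F : Type*) [Field F] : ((Nat.card F : ℕ) : F) = 0 := by
  rcases finite_or_infinite F with h | h
  · have := Fintype.ofFinite F
    rw [Nat.card_eq_fintype_card, Nat.cast_card_eq_zero]
  · rw [Nat.card_eq_zero_of_infinite, Nat.cast_zero]

theorem shearOf_pow {A B : VI F} (h : A →ₗ[F] B) : shearOf k h ^ Nat.card F = 1 := by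
  have : Nat.card F • h = 0 := by
    ext a
    rw [LinearMap.smul_apply, ← map_nsmul, LinearMap.zero_apply, ← Nat.cast_smul_eq_nsmul F,
      natCast_card_eq_zero, zero_smul, map_zero]
  rw [shearOf, ← map_pow, ← ofAdd_nsmul, this, ofAdd_zero, map_one]

/-- The action of the group algebra of shears. -/
def act (M : VIMod F k) (A B : VI F) :
    ShearAlg k A B →ₐ[k] Module.End k (M.obj (VI.sum A B)) :=
  MonoidAlgebra.lift k _ _ (shearHom M A B)

theorem act_shearOf (M : VIMod F k) {A B : VI F} (h : A →ₗ[F] B) (x : M.obj (VI.sum A B)) :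
    act M A B (shearOf k h) x = M.map (VI.shear h) x := by
  rw [act, shearOf, MonoidAlgebra.lift_of]; rfl

theorem act_mul (M : VIMod F k) {A B : VI F} (r s : ShearAlg k A B) (x : M.obj (VI.sum A B)) :
    act M A B (r * s) x = act M A B r (act M A B s x) := by
  rw [map_mul]; rfl

theorem act_one_sub (M : VIMod F k) {A B : VI F} (h : A →ₗ[F] B) (x : M.obj (VI.sum A B)) :
    act M A B (1 - shearOf k h) x = x - M.map (VI.shear h) x := by
  rw [map_sub, map_one, LinearMap.sub_apply, act_shearOf]; rfl

theorem Sub.act_mem {M : VIMod F k} (N : Sub M) {A B : VI F} (r : ShearAlg k A B)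
    {x : M.obj (VI.sum A B)} (hx : x ∈ N.carrier _) : act M A B r x ∈ N.carrier _ := by
  induction r using MonoidAlgebra.induction_on with
  | of h =>
    have := act_shearOf M h.toAdd x
    rw [shearOf, ofAdd_toAdd] at this
    rw [this]
    exact N.map_mem _ hx
  | add r s hr hs => rw [map_add]; exact add_mem hr hs
  | smul c r hr => rw [map_smul]; exact Submodule.smul_mem _ c hr

-- The group algebra of shears is commutative, whereas the `σ_v` live in a noncommutative
-- endomorphism ring; this moves a product from the first setting to the second along an
-- intertwining `κ`.
open scoped Classical in
theorem map_act_prod (M : VIMod F k) {A B Z : VI F} {ι : Type*} (h : ι → A →ₗ[F] B)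
    (κ : VI.sum A B ⟶ Z) (P : ι → Module.End k (M.obj Z))
    (hP : ∀ i x, M.map κ (M.map (VI.shear (h i)) x) = P i (M.map κ x)) (T : Finset ι)
    (comm : (T : Set ι).Pairwise (Function.onFun Commute fun i => 1 - P i))
    (x : M.obj (VI.sum A B)) :
    M.map κ (act M A B (∏ i ∈ T, (1 - shearOf k (h i))) x) =
      T.noncommProd (fun i => 1 - P i) comm (M.map κ x) := by
  induction T using Finset.induction_on with
  | empty => simp
  | insert i T hi ih =>
    rw [Finset.prod_insert hi, Finset.noncommProd_insert_of_notMem _ _ _ _ hi, act_mul, act_one_sub,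
      map_sub, hP, ih (comm.mono (by simp))]
    rfl

theorem map_mapRight_act_prod (M : VIMod F k) {A B B' : VI F} (g : B ⟶ B') {ι : Type*}
    (h : ι → A →ₗ[F] B) (T : Finset ι) (x : M.obj (VI.sum A B)) :
    M.map (VI.mapRight A g) (act M A B (∏ i ∈ T, (1 - shearOf k (h i))) x) =
      act M A B' (∏ i ∈ T, (1 - shearOf k (g.toLinearMap ∘ₗ h i))) (M.map (VI.mapRight A g) x) := by
  classical
  induction T using Finset.induction_on generalizing x with
  | empty => simp
  | insert i T hi ih =>
    rw [Finset.prod_insert hi, Finset.prod_insert hi, mul_comm, act_mul, ih, act_one_sub, mul_comm,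
      act_mul, act_one_sub, map_sub, map_comp_apply, VI.shear_mapRight, ← map_comp_apply]

/-! ### Comparison of families of functionals -/

/-- The vector space with a basis indexed by `ι`. -/
abbrev free (F : Type u) [Field F] (ι : Type u) [Finite ι] : VI F := ⟨ι →₀ F⟩

/-- The linear map `a ↦ φ a • e i`. -/
def elemMap {A : VI F} {ι : Type u} [Finite ι] (φ : A →ₗ[F] F) (i : ι) : A →ₗ[F] free F ι :=
  LinearMap.smulRight (M := ι →₀ F) φ (Finsupp.single i 1)

/-- The transvection of `free F ι` taking `e j` to `e j + e i`. -/
def transvection {ι : Type u} [Finite ι] {i j : ι} (h : i ≠ j) : free F ι ⟶ free F ι where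
  toLinearMap := LinearMap.id + LinearMap.smulRight (M := ι →₀ F) (Finsupp.lapply j)
    (Finsupp.single i 1)
  injective := by
    refine (injective_iff_map_eq_zero _).2 fun b hb => ?_
    have hb' : b + b j • Finsupp.single i 1 = 0 := hb
    have hbj : b j = 0 := by
      simpa [Finsupp.single_eq_of_ne' h] using DFunLike.congr_fun hb' j
    simpa [hbj] using hb'

theorem transvection_elemMap {A : VI F} {ι : Type u} [Finite ι] {i j : ι} (h : i ≠ j)
    (φ : A →ₗ[F] F) :
    (transvection h).toLinearMap ∘ₗ elemMap φ j = elemMap φ j + elemMap φ i := by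
  refine LinearMap.ext fun a => Finsupp.ext fun l => ?_
  simp [transvection, elemMap]

theorem transvection_elemMap_of_ne {A : VI F} {ι : Type u} [Finite ι] {i j l : ι} (h : i ≠ j)
    (hl : l ≠ j) (φ : A →ₗ[F] F) :
    (transvection h).toLinearMap ∘ₗ elemMap φ l = elemMap φ l := by
  refine LinearMap.ext fun a => Finsupp.ext fun l => ?_
  simp [transvection, elemMap, Finsupp.single_eq_of_ne' hl]

/-- The element `∏ i, (1 - s i)`, where `s i` is the shear `a ↦ a + φ i a • e i`. -/
def shearProd (k : Type u) [Field k] {A : VI F} {ι : Type u} [Finite ι] (φ : ι → A →ₗ[F] F)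
    (T : Finset ι) : ShearAlg k A (free F ι) :=
  ∏ i ∈ T, (1 - shearOf k (elemMap (φ i) i))

/-- A repeated functional can be dropped. The transvection `e j ↦ e j + e i` turns the factor `1 - s
j` into `1 - s j * s i` and leaves the others alone. Since `(1 - s j * s i) - s i * (1 - s j) = 1 -
s i`, the submodule contains the element with `1 - s i` squared, and `exists_one_sub_eq_mul_sq`
removes the square. -/
theorem act_shearProd_mem_of_insert (hq : (Nat.card F : k) ≠ 0) {M : VIMod F k} (N : Sub M)
    {A : VI F} (m : M.obj A) {ι : Type u} [Finite ι] [DecidableEq ι] (φ : ι → A →ₗ[F] F)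
    {T : Finset ι} {i j : ι} (hi : i ∈ T) (hj : j ∉ T) (hij : φ j = φ i)
    (h : act M A _ (shearProd k φ (insert j T)) (M.map (VI.inl A _) m) ∈ N.carrier _) :
    act M A _ (shearProd k φ T) (M.map (VI.inl A _) m) ∈ N.carrier _ := by
  have hne : i ≠ j := by rintro rfl; exact hj hi
  have h' := N.map_mem (VI.mapRight A (transvection hne)) h
  rw [shearProd, map_mapRight_act_prod, map_comp_apply, VI.inl_mapRight] at h'
  set s : ι → ShearAlg k A (free F ι) := fun l =>
shearOf k (elemMap (φ l) l)
  set m' := M.map (VI.inl A (free F ι)) m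
  set Q := ∏ l ∈ T.erase i, (1 - s l)
  have hprod : shearProd k φ T = (1 - s i) * Q := (Finset.mul_prod_erase T _ hi).symm
  have h1 : shearProd k φ (insert j T) = (1 - s j) * ((1 - s i) * Q) := by
    rw [← hprod, shearProd, Finset.prod_insert hj]; rfl
  have h2 : ∏ l ∈ insert j T, (1 - shearOf k ((transvection hne).toLinearMap ∘ₗ elemMap (φ l) l)) = (1 - s j * s i) * ((1 - s i) * Q) := by
    rw [← hprod, shearProd, Finset.prod_insert hj]
    congr 1
    · rw [transvection_elemMap, hij, shearOf_add]
      simp only [s, hij]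
    · refine Finset.prod_congr rfl fun l hl => ?_
      rw [transvection_elemMap_of_ne]
      rintro rfl
      exact hj hl
  rw [h1] at h
  rw [h2] at h'
  obtain ⟨r, hr⟩ := exists_one_sub_eq_mul_sq hq
    (shearOf_pow (k := k) (elemMap (φ i) i))
  have h3 : shearProd k φ T =
      r * ((1 - s j * s i) * ((1 - s i) * Q)) - r * s i * ((1 - s j) * ((1 - s i) * Q)) := by
    have hr' : 1 - s i = r * (1 - s i) ^ 2 := hr
    rw [hprod]
    linear_combination Q * hr'
  rw [h3, map_sub, LinearMap.sub_apply, act_mul, act_mul _ (r * s i)]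
  exact sub_mem (N.act_mem _ h') (N.act_mem _ h)

/-- Renaming the basis vectors along an injection. -/
def freeMap {ι κ : Type u} [Finite ι] [Finite κ] (p : ι ↪ κ) : free F ι ⟶ free F κ :=
  ⟨Finsupp.lmapDomain F F p, Finsupp.mapDomain_injective p.injective⟩

theorem map_freeMap_act_shearProd (M : VIMod F k) {A : VI F} (m : M.obj A) {ι κ : Type u}
    [Finite ι] [Finite κ] (p : ι ↪ κ) (φ : κ → A →ₗ[F] F) (T : Finset ι) :
    M.map (VI.mapRight A (freeMap p))
        (act M A _ (shearProd k (φ ∘ p) T) (M.map (VI.inl A _) m)) =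
      act M A _ (shearProd k φ (T.map p)) (M.map (VI.inl A _) m) := by
  rw [shearProd, map_mapRight_act_prod, map_comp_apply, VI.inl_mapRight, shearProd, Finset.prod_map]
  have h (l : ι) : (freeMap p).toLinearMap ∘ₗ elemMap (φ (p l)) l = elemMap (φ (p l)) (p l) := by
    refine LinearMap.ext fun a => ?_
    simp [elemMap, freeMap, Finsupp.mapDomain_single]
  simp only [Function.comp_apply, h]

/-- Adding the factors of `ψ` costs nothing, as submodules are stable under the group algebra. Each
factor of `φ` then repeats one of `ψ` and can be dropped; saturation finally discards the unused
basis vectors. -/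
theorem act_shearProd_mem_of_range (hq : (Nat.card F : k) ≠ 0) {M : VIMod F k} {N : Sub M}
    (hN : N.IsSaturated) {A : VI F} (m : M.obj A) {ι κ : Type u} [Fintype ι] [Fintype κ]
    (φ : ι → A →ₗ[F] F) (ψ : κ → A →ₗ[F] F) (hφψ : ∀ i, ∃ j, ψ j = φ i)
    (h : act M A _ (shearProd k φ Finset.univ) (M.map (VI.inl A _) m) ∈ N.carrier _) :
    act M A _ (shearProd k ψ Finset.univ) (M.map (VI.inl A _) m) ∈ N.carrier _ := by
  classical
  let χ : ι ⊕ κ → A →ₗ[F] F := Sum.elim φ ψ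
  have h1 := N.map_mem (VI.mapRight A (freeMap (Function.Embedding.inl (β := κ)))) h
  rw [show φ = χ ∘ Function.Embedding.inl from rfl, map_freeMap_act_shearProd] at h1
  refine hN (VI.mapRight A (freeMap (Function.Embedding.inr (α := ι)))) _ ?_
  rw [show ψ = χ ∘ Function.Embedding.inr from rfl, map_freeMap_act_shearProd]
  set U : Finset (ι ⊕ κ) := Finset.univ.map Function.Embedding.inl
  set V : Finset (ι ⊕ κ) := Finset.univ.map Function.Embedding.inr
  have hd : Disjoint U V := Finset.disjoint_map_inl_map_inr _ _
  have h2 : act M A _ (shearProd k χ (U ∪ V)) (M.map (VI.inl A _) m) ∈ N.carrier _ := by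
    rw [shearProd, Finset.prod_union hd, mul_comm, act_mul]
    exact N.act_mem _ h1
  suffices ∀ S : Finset ι, act M A _ (shearProd k χ (S.map Function.Embedding.inl ∪ V))
      (M.map (VI.inl A _) m) ∈ N.carrier _ →
      act M A _ (shearProd k χ V) (M.map (VI.inl A _) m) ∈ N.carrier _ from this _ h2
  intro S
  induction S using Finset.induction_on with
  | empty => simp
  | insert i S hi ih =>
    intro hS
    refine ih ?_
    obtain ⟨j, hj⟩ := hφψ i
    rw [Finset.map_insert, Finset.insert_union] at hS
    refine act_shearProd_mem_of_insert hq N m χ (i := Sum.inr j) (j := Sum.inl i) ?_ ?_ hj.symm hS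
    · simp [V]
    · simpa [V] using hi

/-! ### Components of elements of induced modules -/

section Induced

variable {d : ℕ} {Θ : Type u} [AddCommGroup Θ] [Module k Θ]
  (ρ : Representation k (LinearMap.GeneralLinearGroup F (Fin d → F)) Θ)

theorem ofGL_comp_ofGL (σ τ : LinearMap.GeneralLinearGroup F (Fin d → F)) :
    VI.ofGL τ ≫ VI.ofGL σ = VI.ofGL (σ * τ) := rfl

theorem ofGL_comp_injective {X : VI F} (f : VI.std F d ⟶ X)
    {σ τ : LinearMap.GeneralLinearGroup F (Fin d → F)} (h : VI.ofGL σ ≫ f = VI.ofGL τ ≫ f) :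
    σ = τ := by
  refine Units.ext (LinearMap.ext fun x => f.injective ?_)
  exact LinearMap.congr_fun (congrArg VI.Hom.toLinearMap h) x

theorem range_ofGL_comp {X : VI F} (f : VI.std F d ⟶ X)
    (σ : LinearMap.GeneralLinearGroup F (Fin d → F)) :
    LinearMap.range (VI.ofGL σ ≫ f).toLinearMap = LinearMap.range f.toLinearMap :=
  LinearMap.range_comp_of_range_eq_top _
    (LinearEquiv.range (LinearMap.GeneralLinearGroup.toLinearEquiv σ))

/-- `[f] ⊗ θ` as a linear function of `θ`. -/
def tmulHom {X : VI F} (f : VI.std F d ⟶ X) : Θ →ₗ[k] (induced ρ).obj X :=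
  (relations ρ X).mkQ ∘ₗ Finsupp.lsingle f

theorem tmulHom_apply {X : VI F} (f : VI.std F d ⟶ X) (θ : Θ) : tmulHom ρ f θ = tmul ρ f θ := rfl

theorem map_tmul {X Y : VI F} (g : X ⟶ Y) (f : VI.std F d ⟶ X) (θ : Θ) :
    (induced ρ).map g (tmul ρ f θ) = tmul ρ (f ≫ g) θ := by
  change (relations ρ Y).mkQ (preMap (k := k) g (Finsupp.single f θ)) = _
  simp only [preMap, Finsupp.lmapDomain_apply, Finsupp.mapDomain_single]
  rfl

theorem tmul_ofGL_comp {X : VI F} (f : VI.std F d ⟶ X)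
    (σ : LinearMap.GeneralLinearGroup F (Fin d → F)) (θ : Θ) :
    tmul ρ (VI.ofGL σ ≫ f) θ = tmul ρ f (ρ σ θ) :=
  (Submodule.Quotient.eq _).2 (Submodule.subset_span ⟨f, σ, θ, rfl⟩)

theorem induced_hom_ext {X : VI F} {V : Type*} [AddCommGroup V] [Module k V]
    {p q : (induced ρ).obj X →ₗ[k] V} (h : ∀ f θ, p (tmul ρ f θ) = q (tmul ρ f θ)) : p = q :=
  Submodule.linearMap_qext _ (Finsupp.lhom_ext h)

open scoped Classical in
/-- The function `[g] ⊗ θ ↦ σ θ` if `g = f ∘ σ`, and `0` if `g` and `f` have different images. -/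
def preComponent {X : VI F} (f : VI.std F d ⟶ X) : ((VI.std F d ⟶ X) →₀ Θ) →ₗ[k] Θ :=
  Finsupp.lsum k fun g => if h : ∃ σ, VI.ofGL σ ≫ f = g then ρ h.choose else 0

theorem preComponent_ofGL_comp {X : VI F} (f : VI.std F d ⟶ X)
    (σ : LinearMap.GeneralLinearGroup F (Fin d → F)) (θ : Θ) :
    preComponent ρ f (Finsupp.single (VI.ofGL σ ≫ f) θ) = ρ σ θ := by
  have h : ∃ τ, VI.ofGL τ ≫ f = VI.ofGL σ ≫ f := ⟨σ, rfl⟩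
  rw [preComponent, Finsupp.lsum_single, dif_pos h, ofGL_comp_injective f h.choose_spec]

theorem preComponent_of_not {X : VI F} {f g : VI.std F d ⟶ X} (h : ¬ ∃ σ, VI.ofGL σ ≫ f = g)
    (θ : Θ) : preComponent ρ f (Finsupp.single g θ) = 0 := by
  rw [preComponent, Finsupp.lsum_single, dif_neg h, LinearMap.zero_apply]

/-- The component at the image of `f` of an element of the induced module. -/
def component {X : VI F} (f : VI.std F d ⟶ X) : (induced ρ).obj X →ₗ[k] Θ :=
  (relations ρ X).liftQ (preComponent ρ f) <| by
    refine Submodule.span_le.2 ?_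
    rintro _ ⟨g, τ, θ, rfl⟩
    rw [SetLike.mem_coe, LinearMap.mem_ker, map_sub, sub_eq_zero]
    by_cases h : ∃ σ, VI.ofGL σ ≫ f = g
    · obtain ⟨σ, rfl⟩ := h
      rw [← Category.assoc, ofGL_comp_ofGL, preComponent_ofGL_comp, preComponent_ofGL_comp, map_mul]
      rfl
    · rw [preComponent_of_not ρ h, preComponent_of_not ρ]
      rintro ⟨σ, hσ⟩
      refine h ⟨σ * τ⁻¹, ?_⟩
      rw [← ofGL_comp_ofGL, Category.assoc, hσ, ← Category.assoc, ofGL_comp_ofGL, mul_inv_cancel]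
      rfl

theorem component_ofGL_comp {X : VI F} (f : VI.std F d ⟶ X)
    (σ : LinearMap.GeneralLinearGroup F (Fin d → F)) (θ : Θ) :
    component ρ f (tmul ρ (VI.ofGL σ ≫ f) θ) = ρ σ θ :=
  preComponent_ofGL_comp ρ f σ θ

theorem component_self {X : VI F} (f : VI.std F d ⟶ X) (θ : Θ) :
    component ρ f (tmul ρ f θ) = θ := by
  have := component_ofGL_comp ρ f 1 θ
  rwa [map_one, show VI.ofGL 1 ≫ f = f from rfl] at this

theorem component_of_not {X : VI F} {f g : VI.std F d ⟶ X} (h : ¬ ∃ σ, VI.ofGL σ ≫ f = g)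
    (θ : Θ) : component ρ f (tmul ρ g θ) = 0 :=
  preComponent_of_not ρ h θ

/-- Injectivity of `g` keeps distinct images distinct. Together with `exists_component_ne_zero` this
makes the induced module torsion-free. -/
theorem component_map {X Y : VI F} (f : VI.std F d ⟶ X) (g : X ⟶ Y) (x : (induced ρ).obj X) :
    component ρ (f ≫ g) ((induced ρ).map g x) = component ρ f x := by
  suffices component ρ (f ≫ g) ∘ₗ ((induced ρ).map g).hom = component ρ f from
    LinearMap.congr_fun this x
  refine induced_hom_ext ρ fun h θ => ?_
  change component ρ (f ≫ g) ((induced ρ).map g (tmul ρ h θ)) = _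
  rw [map_tmul]
  by_cases hh : ∃ σ, VI.ofGL σ ≫ f = h
  · obtain ⟨σ, rfl⟩ := hh
    rw [Category.assoc, component_ofGL_comp, component_ofGL_comp]
  · rw [component_of_not ρ hh, component_of_not]
    rintro ⟨σ, hσ⟩
    refine hh ⟨σ, VI.hom_ext (LinearMap.ext fun a => g.injective ?_)⟩
    exact LinearMap.congr_fun (congrArg VI.Hom.toLinearMap hσ) a

theorem component_ofGL {X : VI F} (f : VI.std F d ⟶ X)
    (σ : LinearMap.GeneralLinearGroup F (Fin d → F)) (x : (induced ρ).obj X) :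
    component ρ (VI.ofGL σ ≫ f) x = ρ σ⁻¹ (component ρ f x) := by
  suffices component ρ (VI.ofGL σ ≫ f) = ρ σ⁻¹ ∘ₗ component ρ f from LinearMap.congr_fun this x
  refine induced_hom_ext ρ fun g θ => ?_
  rw [LinearMap.comp_apply]
  by_cases h : ∃ τ, VI.ofGL τ ≫ f = g
  · obtain ⟨τ, rfl⟩ := h
    rw [component_ofGL_comp, show VI.ofGL τ ≫ f = VI.ofGL (σ⁻¹ * τ) ≫ VI.ofGL σ ≫ f by
      rw [← Category.assoc, ofGL_comp_ofGL, mul_inv_cancel_left], component_ofGL_comp, map_mul]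
    rfl
  · rw [component_of_not ρ h, map_zero, component_of_not]
    rintro ⟨τ, rfl⟩
    exact h ⟨σ * τ, by rw [← ofGL_comp_ofGL, Category.assoc]⟩

/-- The elements `∏ i, (1 - s i) [F ^ d ⟶ F ^ d + free F ι] ⊗ θ`. -/
def shearElt {ι : Type u} [Fintype ι] (φ : ι → VI.std F d →ₗ[F] F) :
    Θ →ₗ[k] (induced ρ).obj (VI.sum (VI.std F d) (free F ι)) :=
  act (induced ρ) _ _ (shearProd k φ Finset.univ) ∘ₗ tmulHom ρ (VI.inl _ _)

theorem shearElt_apply {ι : Type u} [Fintype ι] (φ : ι → VI.std F d →ₗ[F] F) (θ : Θ) :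
    shearElt ρ φ θ = act (induced ρ) _ _ (shearProd k φ Finset.univ)
      ((induced ρ).map (VI.inl _ _) (tmul ρ (𝟙 _) θ)) := by
  rw [map_tmul, Category.id_comp]; rfl

/-- Factors indexed by `T` never alter a coordinate outside `T`, so no term of the expansion returns
to the image of the plain inclusion. -/
theorem component_act_shearProd {ι : Type u} [Fintype ι] {φ : ι → VI.std F d →ₗ[F] F}
    (T : Finset ι) (θ : Θ) (h : VI.std F d →ₗ[F] free F ι)
    (hh : ∃ i ∉ T, ∃ a, (h a : ι →₀ F) i ≠ 0) :
    component ρ (VI.inl _ _) (act (induced ρ) _ _ (shearProd k φ T)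
      (tmul ρ (VI.inl _ _ ≫ VI.shear h) θ)) = 0 := by
  classical
  induction T using Finset.induction_on generalizing h with
  | empty =>
    obtain ⟨i, -, a, hi⟩ := hh
    rw [shearProd, Finset.prod_empty, map_one, Module.End.one_apply, component_of_not]
    rintro ⟨σ, hσ⟩
    have h1 := congrArg Prod.snd (LinearMap.congr_fun (congrArg VI.Hom.toLinearMap hσ) a)
    have h2 : (0 : ι →₀ F) = 0 + h a := h1
    rw [zero_add] at h2
    rw [← h2] at hi
    exact hi rfl
  | insert j T hj ih =>
    obtain ⟨i, hiT, a, hi⟩ := hh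
    rw [Finset.mem_insert, not_or] at hiT
    rw [shearProd, Finset.prod_insert hj, mul_comm, act_mul, act_one_sub, map_sub, map_sub, map_tmul,
      Category.assoc, VI.shear_comp]
    refine (congrArg₂ _ (ih h ⟨i, hiT.2, a, hi⟩) (ih _ ⟨i, hiT.2, a, ?_⟩)).trans (sub_zero _)
    simpa [elemMap, Finsupp.single_eq_of_ne hiT.1] using hi

/-- In the expanded product every term other than `1` moves the inclusion to one with a different
image. -/
theorem component_shearElt {ι : Type u} [Fintype ι] {φ : ι → VI.std F d →ₗ[F] F}
    (hφ : ∀ i, φ i ≠ 0) (θ : Θ) : component ρ (VI.inl _ _) (shearElt ρ φ θ) = θ := by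
  classical
  rw [shearElt, LinearMap.comp_apply, tmulHom_apply]
  induction (Finset.univ : Finset ι) using Finset.induction_on with
  | empty => rw [shearProd, Finset.prod_empty, map_one, Module.End.one_apply, component_self]
  | insert j T hj ih =>
    rw [shearProd, Finset.prod_insert hj, mul_comm, act_mul, act_one_sub, map_sub, map_sub, map_tmul]
    refine (congrArg₂ _ ih (component_act_shearProd ρ T θ _ ⟨j, hj, ?_⟩)).trans (sub_zero _)
    obtain ⟨a, ha⟩ := DFunLike.ne_iff.1 (hφ j)
    exact ⟨a, by simpa [elemMap] using ha⟩

variable [Finite F]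

instance {X Y : VI F} : Finite (X ⟶ Y) := by
  have : Finite X := Module.finite_of_finite F
  have : Finite Y := Module.finite_of_finite F
  exact Finite.of_injective (fun f : X ⟶ Y => (f.toLinearMap : X → Y))
    fun f g h => VI.hom_ext (DFunLike.coe_injective h)

theorem exists_component_ne_zero {X : VI F} {x : (induced ρ).obj X} (hx : x ≠ 0) :
    ∃ f, component ρ f x ≠ 0 := by
  classical
  have := Fintype.ofFinite (VI.std F d ⟶ X)
  -- One chosen frame for each image: the induced module at `X` is the direct sum of copies of `Θ`
  -- over these frames, and `key` writes the identity as the sum of the projections.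
  let r (g : VI.std F d ⟶ X) : VI.std F d ⟶ X :=
    Quotient.out (Quotient.mk (Setoid.ker fun g : VI.std F d ⟶ X => LinearMap.range g.toLinearMap) g)
  have hr (g) : LinearMap.range (r g).toLinearMap = LinearMap.range g.toLinearMap :=
    Quotient.mk_out (s := Setoid.ker fun g : VI.std F d ⟶ X => LinearMap.range g.toLinearMap) g
  have hr' {g h} (hgh : LinearMap.range g.toLinearMap = LinearMap.range h.toLinearMap) : r g = r h :=
    congrArg Quotient.out (Quotient.sound (s := Setoid.ker _) hgh)
  have key : ∑ f with r f = f, tmulHom ρ f ∘ₗ component ρ f = LinearMap.id := by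
    refine induced_hom_ext ρ fun g θ => ?_
    obtain ⟨σ, hσ⟩ := VI.exists_ofGL_comp (hr g).ge
    rw [LinearMap.sum_apply, Finset.sum_eq_single (r g)]
    · have hg : tmul ρ g θ = tmul ρ (r g) (ρ σ θ) := by rw [← tmul_ofGL_comp, hσ]
      rw [LinearMap.comp_apply, tmulHom_apply, LinearMap.id_apply, hg, component_self]
    · intro f hf hne
      rw [LinearMap.comp_apply, component_of_not, map_zero]
      rintro ⟨τ, rfl⟩
      exact hne ((Finset.mem_filter.1 hf).2.symm.trans (hr' (range_ofGL_comp f τ).symm))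
    · intro h
      exact (h (Finset.mem_filter.2 ⟨Finset.mem_univ _, hr' (hr g)⟩)).elim
  by_contra! hc
  refine hx ?_
  have := LinearMap.congr_fun key x
  rw [LinearMap.sum_apply] at this
  rw [← LinearMap.id_apply (R := k) x, ← this]
  exact Finset.sum_eq_zero fun f _ => by rw [LinearMap.comp_apply, hc, map_zero]

end Induced

/-! ### The operators `L` -/

theorem Sub.noncommProd_mem {M : VIMod F k} (N : Sub M) {X : VI F} {ι : Type*} (T : Finset ι)
    (P : ι → Module.End k (M.obj X)) (comm) (hP : ∀ i ∈ T, ∀ x ∈ N.carrier X, P i x ∈ N.carrier X) :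
    ∀ x ∈ N.carrier X, T.noncommProd P comm x ∈ N.carrier X :=
  Finset.noncommProd_induction T P comm (fun p => ∀ x ∈ N.carrier X, p x ∈ N.carrier X)
    (fun _ _ ha hb x hx => ha _ (hb x hx)) (fun _ hx => hx) hP

section Operators

variable [Finite F] {d : ℕ}

theorem pairwise_commute_one_sub_sigmaEnd (M : VIMod F k) {X : VI F} (f : VI.std F d ⟶ X)
    (T : Set (VI.Triple f)) : T.Pairwise (Function.onFun Commute fun v => 1 - sigmaEnd M v) :=
  fun v _ w _ _ => (Commute.one_left _).sub_left
    ((Commute.one_right _).sub_right (sigmaEnd_commute M v w))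

theorem opL_eq (M : VIMod F k) {X : VI F} (f : VI.std F d ⟶ X) [h : Fintype (VI.Triple f)] :
    opL M f = Finset.univ.noncommProd (fun v => 1 - sigmaEnd M v)
      (pairwise_commute_one_sub_sigmaEnd M f _) := by
  obtain rfl : h = Fintype.ofFinite _ := Subsingleton.elim _ _
  rfl

theorem opL_eq_zero (M : VIMod F k) {X : VI F} {f : VI.std F d ⟶ X} (v : VI.Triple f)
    {x : M.obj (VI.sum X (VI.E f))} (h : sigmaEnd M v x = x) : opL M f x = 0 := by
  classical
  let _ : Fintype (VI.Triple f) := Fintype.ofFinite _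
  rw [opL_eq, ← Finset.noncommProd_erase_mul _ (Finset.mem_univ v), Module.End.mul_apply,
    LinearMap.sub_apply, h, Module.End.one_apply, sub_self, map_zero]

theorem opL_map_extend (M : VIMod F k) {X : VI F} (f : VI.std F d ⟶ X) [Fintype (VI.Triple f)]
    (m : M.obj (VI.std F d)) :
    opL M f (M.map (VI.extend f (VI.E f)) m) =
      M.map (VI.embed f) (act M (VI.std F d) (free F (VI.Triple f))
        (shearProd k (A := VI.std F d) VI.Triple.functional Finset.univ) (M.map (VI.inl _ _) m)) := by
  rw [opL_eq, shearProd, map_act_prod M _ (VI.embed f) (sigmaEnd M), map_comp_apply, VI.inl_embed]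
  · intro v x
    rw [map_comp_apply]
    refine Eq.trans ?_ (map_comp_apply M (VI.embed f) (VI.ofEquiv (VI.sigma v)) x).symm
    exact congrArg (fun g => M.map g x) (VI.shear_embed v)

theorem Sub.opL_mem {M : VIMod F k} (N : Sub M) {X : VI F} (f : VI.std F d ⟶ X)
    {x : M.obj (VI.sum X (VI.E f))} (hx : x ∈ N.carrier _) : opL M f x ∈ N.carrier _ :=
  N.noncommProd_mem _ _ _ (fun _ _ _ hy => sub_mem hy (N.map_mem _ hy)) x hx

variable {Θ : Type u} [AddCommGroup Θ] [Module k Θ]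
  (ρ : Representation k (LinearMap.GeneralLinearGroup F (Fin d → F)) Θ)

theorem opL_tmul_of_range {X : VI F} {f g : VI.std F d ⟶ X}
    (h : ¬ LinearMap.range f.toLinearMap ≤ LinearMap.range g.toLinearMap) (θ : Θ) :
    opL (induced ρ) f (tmul ρ (VI.extend g (VI.E f)) θ) = 0 := by
  obtain ⟨v, hv⟩ := VI.exists_coord_comp_eq_zero h
  refine opL_eq_zero _ v ((map_tmul ρ _ _ θ).trans ?_)
  congr 1
  refine VI.hom_ext (LinearMap.ext fun a => (VI.sigma_apply v _).trans ?_)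
  have h1 : v.coord (g.toLinearMap a) = 0 := LinearMap.congr_fun hv a
  have h2 : v.coord (g.toLinearMap a) +
      v.coord (Finsupp.linearCombination F VI.Triple.α (0 : VI.Triple f →₀ F)) = 0 := by
    rw [h1, map_zero, map_zero, add_zero]
  exact (congrArg (fun c : F => (VI.extend g (VI.E f)).toLinearMap a +
    c • (VI.inE f (VI.e v) - VI.inX f v.α)) h2).trans (by rw [zero_smul, add_zero])

/-- By `opL_tmul_of_range` the terms with image other than that of `f` die; equality of dimensions
turns containment of images into equality. -/
theorem opL_map_inl {X : VI F} (f : VI.std F d ⟶ X) (x : (induced ρ).obj X) :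
    opL (induced ρ) f ((induced ρ).map (VI.inl X (VI.E f)) x) =
      opL (induced ρ) f (tmul ρ (VI.extend f (VI.E f)) (component ρ f x)) := by
  suffices opL (induced ρ) f ∘ₗ ((induced ρ).map (VI.inl X (VI.E f))).hom =
      opL (induced ρ) f ∘ₗ tmulHom ρ (VI.extend f (VI.E f)) ∘ₗ component ρ f from
    LinearMap.congr_fun this x
  refine induced_hom_ext ρ fun g θ => ?_
  change opL (induced ρ) f ((induced ρ).map (VI.inl X (VI.E f)) (tmul ρ g θ)) =
    opL (induced ρ) f (tmul ρ (VI.extend f (VI.E f)) (component ρ f (tmul ρ g θ)))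
  rw [map_tmul]
  by_cases h : ∃ σ, VI.ofGL σ ≫ f = g
  · obtain ⟨σ, rfl⟩ := h
    rw [component_ofGL_comp, Category.assoc, tmul_ofGL_comp]
    rfl
  · rw [component_of_not ρ h, ← tmulHom_apply, ← tmulHom_apply, map_zero, map_zero]
    refine opL_tmul_of_range ρ (fun hle => h ?_) θ
    refine VI.exists_ofGL_comp (Submodule.eq_of_le_of_finrank_eq hle ?_).ge
    rw [LinearMap.finrank_range_of_inj f.injective, LinearMap.finrank_range_of_inj g.injective]

theorem opL_tmul {X : VI F} (f : VI.std F d ⟶ X) [Fintype (VI.Triple f)] (θ : Θ) :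
    opL (induced ρ) f (tmul ρ (VI.extend f (VI.E f)) θ) =
      (induced ρ).map (VI.embed f) (shearElt ρ (VI.Triple.functional (f := f)) θ) := by
  rw [shearElt_apply, ← opL_map_extend, map_tmul, Category.id_comp]

variable {ρ}

/-- A generator with `θ ≠ 0` is nonzero, since its component at the embedded inclusion is `θ`. -/
theorem subM_exists_ne_zero [Nontrivial Θ] {n : ℕ} (hn : d ≤ n) :
    ∃ (X : VI F) (x : (induced ρ).obj X), x ∈ (subM ρ hn).carrier X ∧ x ≠ 0 := by
  obtain ⟨θ, hθ⟩ := exists_ne (0 : Θ)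
  refine ⟨_, _, Submodule.subset_span ⟨𝟙 _, _, ⟨θ, rfl⟩, (map_id_apply _ _).symm⟩, fun h0 => hθ ?_⟩
  let _ : Fintype (VI.Triple (VI.stdIncl (F := F) hn)) := Fintype.ofFinite _
  have h1 := opL_tmul ρ (VI.stdIncl (F := F) hn) θ
  rw [show opL (induced ρ) (VI.stdIncl hn) _ = 0 from h0] at h1
  rw [← component_shearElt ρ (φ := VI.Triple.functional (f := VI.stdIncl hn)) (fun v =>
      (VI.Triple.isNormalized v).ne_zero) θ,
    ← component_map ρ _ (VI.embed (VI.stdIncl (F := F) hn))]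
  exact (congrArg _ h1.symm).trans (map_zero _)

theorem subM_le (hq : (Nat.card F : k) ≠ 0) (hρ : ρ.IsIrreducible) {n : ℕ} (hn : d ≤ n)
    {N : Sub (induced ρ)} (hN : N.IsSaturated) {X : VI F} {x : (induced ρ).obj X}
    (hx : x ∈ N.carrier X) (hx0 : x ≠ 0) (Y : VI F) : (subM ρ hn).carrier Y ≤ N.carrier Y := by
  let _ : Fintype (VI.Triple (VI.stdIncl (F := F) hn)) := Fintype.ofFinite _
  obtain ⟨f, hf⟩ := exists_component_ne_zero ρ hx0
  let φ := VI.Triple.functional (f := VI.stdIncl (F := F) hn)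
  -- Quantifying over all `σ` makes stability under `GL_d` automatic; `hS` then has to treat every
  -- translate of the component.
  let S : Subrepresentation ρ :=
    { toSubmodule := ⨅ σ, (N.carrier _).comap (shearElt ρ φ ∘ₗ ρ σ)
      apply_mem_toSubmodule := by
        intro τ θ hθ
        simp only [Submodule.mem_iInf, Submodule.mem_comap, LinearMap.comp_apply] at hθ ⊢
        intro σ
        rw [← Module.End.mul_apply, ← map_mul]
        exact hθ _ }
  have hS (σ) : shearElt ρ φ (ρ σ (component ρ f x)) ∈ N.carrier _ := by
    -- Reframing the same image by `σ⁻¹` replaces the component of `x` by its translate under `σ`.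
    let g := VI.ofGL σ⁻¹ ≫ f
    let _ : Fintype (VI.Triple g) := Fintype.ofFinite _
    have h1 := N.opL_mem g (N.map_mem (VI.inl X (VI.E g)) hx)
    rw [opL_map_inl, opL_tmul, show component ρ g x = _ from component_ofGL ρ f σ⁻¹ x, inv_inv]
      at h1
    have h2 := hN _ _ h1
    rw [shearElt_apply] at h2 ⊢
    -- The functionals of `g` are normalized, and every normalized functional comes from a triple of
    -- the standard inclusion.
    refine act_shearProd_mem_of_range hq hN _ _ _ (fun v => ?_) h2
    exact VI.exists_functional_eq _ v.isNormalized
  have htop : S = ⊤ := by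
    refine (hρ.eq_bot_or_eq_top S).resolve_left fun hbot => hf ?_
    have : component ρ f x ∈ S.toSubmodule := by
      simpa [S, Submodule.mem_iInf] using hS
    rw [hbot] at this
    exact (Submodule.mem_bot k).1 this
  refine Submodule.span_le.2 ?_
  rintro _ ⟨g, _, ⟨θ, rfl⟩, rfl⟩
  refine N.map_mem _ ?_
  have hθ : θ ∈ S.toSubmodule := by rw [htop]; trivial
  have h1 := (Submodule.mem_iInf _).1 hθ 1
  rw [map_one] at h1
  change opL (induced ρ) (VI.stdIncl hn) _ ∈ _
  rw [opL_tmul ρ (VI.stdIncl hn)]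
  exact N.map_mem _ h1

end Operators

/-! ### Subobjects in the generic category -/

theorem app_map (M : VIMod F k) {N : VIMod F k} (f : M ⟶ N) {X Y : VI F} (g : X ⟶ Y)
    (x : M.obj X) : f.app Y (M.map g x) = N.map g (f.app X x) :=
  NatTrans.naturality_apply f g x

/-- The hypothesis says that every class in the cokernel is killed by some morphism of `VI`. -/
theorem epiModSerre_of_exists {M N : VIMod F k} (f : M ⟶ N)
    (h : ∀ (X : VI F) (x : N.obj X), ∃ (Y : VI F) (g : X ⟶ Y) (y : M.obj Y),
      f.app Y y = N.map g x) : (IsTorsion F k).epiModSerre f := by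
  intro X z
  obtain ⟨x, rfl⟩ := (ModuleCat.epi_iff_surjective ((cokernel.π f).app X)).1 inferInstance z
  obtain ⟨Y, g, y, hy⟩ := h X x
  refine ⟨Y, g, ?_⟩
  rw [← app_map, ← hy, ← ModuleCat.comp_apply, ← NatTrans.comp_app, cokernel.condition]
  rfl

/-- The range of a morphism, as a submodule. -/
def rangeSub {M N : VIMod F k} (f : M ⟶ N) : Sub N where
  carrier X := LinearMap.range (f.app X).hom
  map_mem := by
    rintro X Y g _ ⟨x, rfl⟩
    exact ⟨M.map g x, app_map M f g x⟩

/-- The preimage of a submodule. -/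
def Sub.comap {M N : VIMod F k} (f : M ⟶ N) (S : Sub N) : Sub M where
  carrier X := (S.carrier X).comap (f.app X).hom
  map_mem := by
    intro X Y g x hx
    change f.app Y (M.map g x) ∈ S.carrier Y
    rw [app_map]
    exact S.map_mem g hx

/-- The restriction of a morphism to the preimage of a submodule. -/
def Sub.comapHom {M N : VIMod F k} (f : M ⟶ N) (S : Sub N) : (S.comap f).toMod ⟶ S.toMod where
  app X := ModuleCat.ofHom ((f.app X).hom.restrict fun _ hx => hx)
  naturality _ _ g := ModuleCat.hom_ext (LinearMap.ext fun x => Subtype.ext (app_map M f g x.1))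

theorem Sub.comapHom_incl {M N : VIMod F k} (f : M ⟶ N) (S : Sub N) :
    S.comapHom f ≫ S.incl = (S.comap f).incl ≫ f := rfl

open ObjectProperty.SerreClassLocalization in
/-- A submodule that is generically contained in each nonzero submodule is contained in each
nonzero subobject of the generic category. -/
theorem mk_map_incl_le {I : VIMod F k} (S : Sub I)
    (hS : ∀ (N : Sub I) (X : VI F) (x : I.obj X), x ∈ N.carrier X → x ≠ 0 →
      ∀ Y, S.carrier Y ≤ N.saturation.carrier Y)
    {A : Generic F k} (a : A ⟶ (T F k).obj I) [Mono a] (ha : a ≠ 0) :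
    Subobject.mk ((T F k).map S.incl) ≤ Subobject.mk a := by
  have := Localization.essSurj (T F k) (IsTorsion F k).isoModSerre
  let e := (T F k).objObjPreimageIso A
  -- Up to isomorphism of its source, `a` becomes the image under `T` of an honest morphism `φ.f`,
  -- whose range is a nonzero submodule to which `hS` applies.
  obtain ⟨φ, hφ⟩ := Localization.exists_rightFraction (T F k) (IsTorsion F k).isoModSerre (e.hom ≫ a)
  have hs : IsIso ((T F k).map φ.s) := Localization.inverts (T F k) (IsTorsion F k).isoModSerre _ φ.hs
  have hf : (T F k).map φ.f = (T F k).map φ.s ≫ e.hom ≫ a := by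
    rw [hφ, MorphismProperty.RightFraction.map_s_comp_map]
  have hmono : Mono ((T F k).map φ.f) := by
    rw [hf]
    exact mono_comp' (IsIso.mono_of_iso _) (mono_comp' (IsIso.mono_of_iso _) ‹_›)
  have hne : φ.f ≠ 0 := by
    intro h0
    rw [h0, Functor.map_zero, ← Category.assoc] at hf
    exact ha ((cancel_epi ((T F k).map φ.s ≫ e.hom)).1 (by rw [← hf, comp_zero]))
  obtain ⟨X, y, hy⟩ : ∃ (X : VI F) (y : φ.X'.obj X), φ.f.app X y ≠ 0 := by
    by_contra! hc
    exact hne (NatTrans.ext (funext fun X => ModuleCat.hom_ext (LinearMap.ext fun y => hc X y)))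
  -- Generically `S` agrees with its preimage under `φ.f`: injectivity is inherited from `T(φ.f)`,
  -- and surjectivity holds because elements of `S` eventually enter the range. Inverting this map
  -- factors `S` through `a`.
  have hp : (IsTorsion F k).isoModSerre (S.comapHom φ.f) := by
    constructor
    · rw [← mono_map_iff (T F k)]
      have : Mono ((T F k).map (S.comapHom φ.f) ≫ (T F k).map S.incl) := by
        rw [← Functor.map_comp, Sub.comapHom_incl, Functor.map_comp]
        exact mono_comp' inferInstance hmono
      exact mono_of_mono _ ((T F k).map S.incl)
    · refine epiModSerre_of_exists _ fun Y z => ?_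
      obtain ⟨Z, g, w, hw⟩ := hS (rangeSub φ.f) X _ ⟨y, rfl⟩ hy Y z.2
      have hw' : φ.f.app Z w = I.map g z.1 := hw
      refine ⟨Z, g, ⟨w, ?_⟩, Subtype.ext hw'⟩
      change φ.f.app Z w ∈ S.carrier Z
      rw [hw']
      exact S.map_mem g z.2
  have : IsIso ((T F k).map (S.comapHom φ.f)) := Localization.inverts (T F k) (IsTorsion F k).isoModSerre _ hp
  refine Subobject.mk_le_mk_of_comm (inv ((T F k).map (S.comapHom φ.f)) ≫
    (T F k).map (S.comap φ.f).incl ≫ (T F k).map φ.s ≫ e.hom) ?_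
  rw [Category.assoc, Category.assoc, Category.assoc, ← hf, IsIso.inv_comp_eq, ← Functor.map_comp,
    ← Functor.map_comp, Sub.comapHom_incl]

/-! ### Least nonzero subobjects -/

/-- A nonzero mono into `S` gives a nonzero subobject of `X`, which must contain `S`; this
containment is a section of the mono. -/
theorem simple_of_mk_le {C : Type*} [Category C] [HasZeroMorphisms C] {S X : C} (i : S ⟶ X) [Mono i]
    (hi : i ≠ 0) (h : ∀ {A : C} (a : A ⟶ X) [Mono a], a ≠ 0 → Subobject.mk i ≤ Subobject.mk a) :
    Simple S where
  mono_isIso_iff_nonzero {Y} f _ := by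
    constructor
    · rintro hf rfl
      refine hi ?_
      rw [← cancel_epi (0 : Y ⟶ S), zero_comp, zero_comp]
    · intro hf
      have hle := h (f ≫ i) fun h0 => hf ((cancel_mono i).1 (by rw [h0, zero_comp]))
      have : IsSplitEpi f := IsSplitEpi.mk' ⟨Subobject.ofMkLEMk _ _ hle, by
        rw [← cancel_mono i, Category.assoc, Subobject.ofMkLEMk_comp, Category.id_comp]⟩
      exact isIso_of_mono_of_isSplitEpi f

/-- A simple subobject contains `S`, and the containment, being a nonzero mono into a simple object,
is an isomorphism. -/
theorem isSocle_of_mk_le {C : Type*} [Category C] [HasZeroMorphisms C] {S X : C} (i : S ⟶ X)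
    [Mono i] (hi : i ≠ 0)
    (h : ∀ {A : C} (a : A ⟶ X) [Mono a], a ≠ 0 → Subobject.mk i ≤ Subobject.mk a) :
    IsSocle (Subobject.mk i) := by
  have := simple_of_mk_le i hi h
  refine ⟨fun A (hA : Simple (A : C)) => ?_,
    fun B hB => hB (Simple.of_iso (Subobject.underlyingIso i))⟩
  have hA0 : A.arrow ≠ 0 := fun h0 => id_nonzero (A : C) <| by
    rw [← cancel_mono A.arrow, h0, comp_zero, comp_zero]
  have hle := h A.arrow hA0
  rw [Subobject.mk_arrow] at hle
  have hne : Subobject.ofMkLE i A hle ≠ 0 := fun h0 => hi <| by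
    rw [← Subobject.ofMkLE_arrow hle, h0, zero_comp]
  have : IsIso (Subobject.ofMkLE i A hle) := isIso_of_mono_of_nonzero hne
  refine Subobject.le_mk_of_comm (inv (Subobject.ofMkLE i A hle)) ?_
  rw [IsIso.inv_comp_eq, Subobject.ofMkLE_arrow]

/-! ### Torsion-freeness and generic nonvanishing -/

section

variable [Finite F] {d : ℕ} {Θ : Type u} [AddCommGroup Θ] [Module k Θ]
  (ρ : Representation k (LinearMap.GeneralLinearGroup F (Fin d → F)) Θ)

theorem eq_zero_of_map_eq_zero {X Y : VI F} (g : X ⟶ Y) {x : (induced ρ).obj X}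
    (h : (induced ρ).map g x = 0) : x = 0 := by
  by_contra hx
  obtain ⟨f, hf⟩ := exists_component_ne_zero ρ hx
  rw [← component_map ρ f g, h, map_zero] at hf
  exact hf rfl

theorem map_incl_subM_ne_zero [Nontrivial Θ] {n : ℕ} (hn : d ≤ n) :
    (T F k).map (subM ρ hn).incl ≠ 0 := by
  intro h0
  obtain ⟨X, x, hx, hx0⟩ := subM_exists_ne_zero (ρ := ρ) hn
  have hz : IsZero ((T F k).obj (subM ρ hn).toMod) := by
    rw [IsZero.iff_id_eq_zero, ← cancel_mono ((T F k).map (subM ρ hn).incl), h0, comp_zero, comp_zero]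
  rw [ObjectProperty.SerreClassLocalization.isZero_obj_iff _ (IsTorsion F k)] at hz
  obtain ⟨Y, g, hg⟩ := hz X ⟨x, hx⟩
  exact hx0 (eq_zero_of_map_eq_zero ρ g (congrArg Subtype.val hg))

end

end VIMod

end

theorem mainTheorem8 {F : Type u} [Field F] [Finite F] {k : Type u} [Field k]
    (hq : (Nat.card F : k) ≠ 0) {d : ℕ} {Θ : Type u} [AddCommGroup Θ] [Module k Θ]
    (ρ : Representation k (LinearMap.GeneralLinearGroup F (Fin d → F)) Θ)
    (hρ : ρ.IsIrreducible) (n : ℕ) (hn : d ≤ n) :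
    Simple ((VIMod.T F k).obj (VIMod.subM ρ hn).toMod) ∧
      IsSocle (Subobject.mk ((VIMod.T F k).map (VIMod.subM ρ hn).incl)) := by
  have : Nontrivial Θ := by
    by_contra hc
    rw [not_nontrivial_iff_subsingleton] at hc
    obtain ⟨S, S', h⟩ := hρ.exists_pair_ne
    exact h (SetLike.ext fun x => by
      rw [Subsingleton.elim x 0]
      exact iff_of_true S.toSubmodule.zero_mem S'.toSubmodule.zero_mem)
  have h0 := VIMod.map_incl_subM_ne_zero ρ hn
  have hle {A : VIMod.Generic F k} (a : A ⟶ (VIMod.T F k).obj (VIMod.induced ρ)) [Mono a]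
      (ha : a ≠ 0) : Subobject.mk ((VIMod.T F k).map (VIMod.subM ρ hn).incl) ≤ Subobject.mk a :=
    VIMod.mk_map_incl_le _ (fun N X x hx hx0 => VIMod.subM_le hq hρ hn N.saturation_isSaturated
      (N.le_saturation X hx) hx0) a ha
  exact ⟨VIMod.simple_of_mk_le _ h0 hle, VIMod.isSocle_of_mk_le _ h0 hle⟩
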